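/- **Terms.** Terms, up to $\alpha$-equivalence, are $M,N ::= x \mid \lambda x.M \mid M\,N \mid M[x:=N] \mid W_x(M) \mid C_x^{y,z}(M)$, where $\lambda x$ binds $x$ in $M$, $M[x:=N]$ binds $x$ in $M$ (not in $N$), $W_x(M)$ binds nothing and $C_x^{y,z}(M)$ binds $y\neq z$ in $M$ ($x$ being outside this scope). Free variables are as usual, with $fv(W_x(M))=fv(M)\cup\{x\}$, and $fv(C_x^{y,z}(M))=(fv(M)\setminus\{y,z\})\cup\{x\}$ if $y\in fv(M)$ or $z\in fv(M)$, and $fv(M)$ otherwise. *Pure $\lambda$-terms* use only the first three constructs, *$\lambda S$-terms* only the first four. *$\lambda lxr$-terms* are the linear terms: $x$ is linear; $M\,N$ is linear if $M,N$ are and $fv(M)\cap fv(N)=\emptyset$; $\lambda x.M$ is linear if $M$ is and $x\in fv(M)$; $M[x:=N]$ is linear if $M,N$ are, $x\in fv(M)$ and $(fv(M)\setminus\{x\})\cap fv(N)=\emptyset$; $W_x(M)$ is linear if $M$ is and $x\notin fv(M)$; $C_x^{y,z}(M)$ is linear if $M$ is, $y,z\in fv(M)$ and $x\notin fv(M)$.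 **Reduction.** All rules below are closed under all term constructs, and bound names are chosen so that no capture occurs; a term is strongly normalising if it starts no infinite reduction sequence. *$\lambda$*: $(\lambda x.M)N\to M\{x:=N\}$ (implicit substitution). *$\lambda S$* (modulo the congruence generated by $M[x:=N_1][y:=N_2]\equiv M[y:=N_2][x:=N_1]$ for $x\ne y$, $x\notin fv(N_2)$, $y\notin fv(N_1)$): $(\lambda x.M)N\to M[x:=N]$; $y[x:=N]\to y$ for $y\neq x$; $x[x:=N]\to N$; $(M_1M_2)[x:=N]\to M_1[x:=N]\,M_2[x:=N]$ if $x\in fv(M_1)\cap fv(M_2)$; $(M_1M_2)[x:=N]\to M_1\,(M_2[x:=N])$ if $x\notin fv(M_1)$, $x\in fv(M_2)$; $(M_1M_2)[x:=N]\to M_1[x:=N]\,M_2$ if $x\notin fv(M_2)$; $(\lambda y.M)[x:=N]\to\lambda y.M[x:=N]$ if $y \neq x$, $y\notin fv(N)$; $M_1[y:=M_2][x:=N]\to M_1[x:=N][y:=M_2[x:=N]]$ if $x\in fv(M_1)\cap fv(M_2)$, $y\notin fv(N)$; $M_1[y:=M_2][x:=N]\to M_1[y:=M_2[x:=N]]$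 if $x\notin fv(M_1)$, $x\in fv(M_2)$. *$\lambda lxr$* (on linear terms), reduction rules: $(\lambda x.M)N\to M[x:=N]$; $x[x:=N]\to N$; $(M_1M_2)[x:=N]\to M_1[x:=N]\,M_2$ if $x\in fv(M_1)$; $(M_1M_2)[x:=N]\to M_1\,(M_2[x:=N])$ if $x\in fv(M_2)$; $(\lambda y.M)[x:=N]\to\lambda y.M[x:=N]$ if $y\ne x$, $y\notin fv(N)$; $W_y(M)[x:=N]\to W_y(M[x:=N])$ if $y\neq x$; $W_x(M)[x:=N]\to W_{fv(N)}(M)$; $C_x^{y,z}(M)[x:=N]\to C_X^{Y,Z}(M[y:=N_1][z:=N_2])$, where $X=fv(N)$, $Y$ and $Z$ are fresh copies of $X$, and $N_1$, $N_2$ are $N$ with $X$ renamed to $Y$, resp. $Z$; $M_1[y:=M_2][x:=N]\to M_1[y:=M_2[x:=N]]$ if $x\in fv(M_2)$; $\lambda x.W_y(M)\to W_y(\lambda x.M)$ if $x\ne y$; $W_y(M)\,N\to W_y(M\,N)$; $M\,W_y(N)\to W_y(M\,N)$; $M[x:=W_y(N)]\to W_y(M[x:=N])$; $C_w^{y,z}(W_y(M))\to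 M\{z:=w\}$; $C_w^{y,z}(W_x(M))\to W_x(C_w^{y,z}(M))$ if $x\neq y,z$; $C_w^{y,z}(\lambda x.M)\to\lambda x.C_w^{y,z}(M)$; $C_w^{y,z}(M\,N)\to C_w^{y,z}(M)\,N$ if $y,z\in fv(M)$; $C_w^{y,z}(M\,N)\to M\,C_w^{y,z}(N)$ if $y,z\in fv(N)$; $C_w^{y,z}(M[x:=N])\to M[x:=C_w^{y,z}(N)]$ if $y,z\in fv(N)$; modulo the congruence generated by $C_w^{x,v}(C_x^{z,y}(M))\equiv C_w^{x,y}(C_x^{z,v}(M))$ for $x\ne y,v$; $C_x^{y,z}(M)\equiv C_x^{z,y}(M)$; $C_{x'}^{y',z'}(C_x^{y,z}(M))\equiv C_x^{y,z}(C_{x'}^{y',z'}(M))$ for $x\neq y',z'$ and $x'\neq y,z$; $W_x(W_y(M))\equiv W_y(W_x(M))$; $M[x:=N_1][y:=N_2]\equiv M[y:=N_2][x:=N_1]$ for $y\notin fv(N_1)$, $x\notin fv(N_2)$; $C_w^{y,z}(M)[x:=N]\equiv C_w^{y,z}(M[x:=N])$ for $x\neq w$ and $y,z\notin fv(N)$.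 **Non-idempotent intersection types.** $F$-types $F::=\tau\mid A\to F$ ($\tau$ in a countably infinite set of atoms), $A$-types $A::=F\mid A\cap A$, $U$-types $U::=A\mid\omega$, where $\cap$ is extended to $U$-types with $\omega$ as neutral element. $\approx$ is the congruence for $\cap$ (not underneath arrows) generated by associativity and commutativity, and $U\subseteq V$ means $U\approx V\cap U'$ for some $U'$. A context is a map $\Gamma$ from variables to $U$-types with $\Gamma(x)=\omega$ for all but finitely many $x$; $\cap$ on contexts is pointwise, and $\Gamma,x{:}U$ is used when $\Gamma(x)=\omega$. The judgement $\Gamma\vdash_\cap M:U$ is derived by the rules: $x{:}F\vdash x:F$; from $\Gamma,x{:}U\vdash M:F$ and $A\subseteq U$ infer $\Gamma\vdash\lambda x.M:A\to F$; from $\Gamma\vdash M:A\to F$ and $\Delta\vdash N:A$ infer $\Gamma\cap\Delta\vdash M\,N:F$; from $\Gamma\vdash M:A$ and $\Delta\vdash M:B$ infer $\Gamma\cap\Delta\vdash M:A\cap B$; $\vdash M:\omega$; from $\Gamma\vdash N:A$ and $\Delta,x{:}U\vdash M:F$ with $U\in\{A,\omega\}$ infer $\Gamma\cap\Delta\vdash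 M[x:=N]:F$; from $\Gamma,x{:}U,y{:}V_1,z{:}V_2\vdash M:F$ infer $\Gamma,x{:}U\cap(V_1\cap V_2)\vdash C_x^{y,z}(M):F$; from $\Gamma,x{:}U\vdash M:F$ infer $\Gamma,x{:}U\cap A\vdash W_x(M):F$. **Filters.** An *I-filter* is a set of $A$-types closed under $\cap$ and upward closed for $\subseteq$. $\bot=\emptyset$; *values* are the non-empty I-filters; $\mathcal D$ is the set of values and $\mathcal D^*$ the set of lists of values. $u@v$ is the smallest I-filter containing $\{F\mid\exists A\in v,\ (A\to F)\in u\}$. For an environment $\rho$ (a map from variables to I-filters) let $[\![M]\!]_\rho=\{A\mid\exists\Gamma,\ \Gamma\vdash_\cap M:A\text{ and for all }x,\ \Gamma(x)=\omega\text{ or }\Gamma(x)\in\rho(x)\}$. **System $\mathcal S$.** Types $\mathfrak A::=\alpha\mid\mathfrak A\to\mathfrak B\mid\mathfrak A\cap\mathfrak B\mid\forall\alpha\,\mathfrak A$ up to $\alpha$-conversion. Contexts $\mathbf\Gamma$ are partial maps from variables to types. The rules are: $\mathbf\Gamma,x{:}\mathfrak A\vdash x:\mathfrak A$; from $\mathbf\Gamma,x{:}\mathfrak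 A\vdash M:\mathfrak B$ infer $\mathbf\Gamma\vdash\lambda x.M:\mathfrak A\to\mathfrak B$; from $\mathbf\Gamma\vdash M:\mathfrak A\to\mathfrak B$ and $\mathbf\Gamma\vdash N:\mathfrak A$ infer $\mathbf\Gamma\vdash M\,N:\mathfrak B$; from $\mathbf\Gamma\vdash M:\mathfrak A$ and $\mathbf\Gamma\vdash M:\mathfrak B$ infer $\mathbf\Gamma\vdash M:\mathfrak A\cap\mathfrak B$; from $\mathbf\Gamma\vdash M:\mathfrak A\cap\mathfrak B$ infer $\mathbf\Gamma\vdash M:\mathfrak A$ and $\mathbf\Gamma\vdash M:\mathfrak B$; from $\mathbf\Gamma\vdash M:\mathfrak A$ with $\alpha$ not free in $\mathbf\Gamma$ infer $\mathbf\Gamma\vdash M:\forall\alpha\,\mathfrak A$; from $\mathbf\Gamma\vdash M:\forall\alpha\,\mathfrak A$ infer $\mathbf\Gamma\vdash M:\mathfrak A\{\alpha:=\mathfrak B\}$; from $\mathbf\Gamma\vdash N:\mathfrak A$ and $\mathbf\Gamma,x{:}\mathfrak A\vdash M:\mathfrak B$ infer $\mathbf\Gamma\vdash M[x:=N]:\mathfrak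 B$; from $\mathbf\Gamma\vdash M:\mathfrak B$ and $x\notin\mathrm{dom}(\mathbf\Gamma)$ infer $\mathbf\Gamma,x{:}\mathfrak A\vdash W_x(M):\mathfrak B$; from $\mathbf\Gamma,y{:}\mathfrak A,z{:}\mathfrak A\vdash M:\mathfrak B$ and $x\notin\mathrm{dom}(\mathbf\Gamma)$ infer $\mathbf\Gamma,x{:}\mathfrak A\vdash C_x^{y,z}(M):\mathfrak B$. **Interpretation of types.** For a value $u$ and a list $\vec v=(v_1,\dots,v_n)$ of values, $u\perp\vec v$ means $(\cdots(u@v_1)\cdots)@v_n\neq\bot$; for $Y\subseteq\mathcal D^*$ let $Y^\perp=\{u\in\mathcal D\mid\forall\vec v\in Y,\ u\perp\vec v\}$. A valuation $\sigma$ maps type variables to **non-empty** subsets of $\mathcal D^*$. Put $[\![\mathfrak A]\!]_\sigma=([\![\mathfrak A]\!]^-_\sigma)^\perp$ where $[\![\alpha]\!]^-_\sigma=\sigma(\alpha)$, $[\![\mathfrak A\to\mathfrak B]\!]^-_\sigma=\{u::\vec v\mid u\in[\![\mathfrak A]\!]_\sigma,\ \vec v\in[\![\mathfrak B]\!]^-_\sigma\}$,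 $[\![\mathfrak A\cap\mathfrak B]\!]^-_\sigma=[\![\mathfrak A]\!]^-_\sigma\cup[\![\mathfrak B]\!]^-_\sigma$, $[\![\forall\alpha\,\mathfrak A]\!]^-_\sigma=\bigcup_{\emptyset\neq Y\subseteq\mathcal D^*}[\![\mathfrak A]\!]^-_{\sigma,\alpha\mapsto Y}$. Let $[\![\mathbf\Gamma]\!]_\sigma$ be the set of environments $\rho$ with $\rho(x)\in[\![\mathfrak A]\!]_\sigma$ for all $(x{:}\mathfrak A)\in\mathbf\Gamma$. **Statement.** If $\mathbf\Gamma\vdash_{\mathcal S}M:\mathfrak A$, then: 1. for all valuations $\sigma$ and all $\rho\in[\![\mathbf\Gamma]\!]_\sigma$, $[\![M]\!]_\rho\neq\bot$; 2. there exist a context $\Gamma$ and an $A$-type $A$ such that $\Gamma\vdash_\cap M:A$; 3. if $M$ is a pure $\lambda$-term, then $M$ is strongly normalising in the $\lambda$-calculus; if $M$ is a $\lambda S$-term, then $M$ is strongly normalising in $\lambda S$; if $M$ is a $\lambda lxr$-term, then $M$ is strongly normalising in $\lambda lxr$. -/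

import Mathlib

namespace ESub

/-! ### Terms

Terms up to `α`-equivalence are represented by de Bruijn indices. A variable is a natural number;
going under a binder shifts the free variables up. -/

/-- The common grammar `x | λx.M | M N | M[x := N] | W_x(M) | C_x^{y,z}(M)`.
* `lam M` and `sub M N` (for `M[x := N]`) bind the index `0` of `M` (and nothing in `N`);
* `weak x M` binds nothing: `x` is a free variable of `W_x(M)`;
* `contr x M` binds in `M` the index `0` (for `y`) and the index `1` (for `z`); the variable `x`
  lives outside the binder, so inside `M` it would be the index `x + 2`. -/
inductive Tm : Type
  | var (x : ℕ) : Tm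
  | lam (M : Tm) : Tm
  | app (M N : Tm) : Tm
  | sub (M N : Tm) : Tm
  | weak (x : ℕ) (M : Tm) : Tm
  | contr (x : ℕ) (M : Tm) : Tm

/-- Prepend a value at the index `0`. -/
def scons {α : Type*} (a : α) (f : ℕ → α) : ℕ → α
  | 0 => a
  | n + 1 => f n

/-- Lift a renaming under one binder. -/
def up (r : ℕ → ℕ) : ℕ → ℕ := scons 0 (fun n => r n + 1)

namespace Tm

/-- Renaming of the free variables (capture-avoiding). -/
def rename : Tm → (ℕ → ℕ) → Tm
  | var x, r => var (r x)
  | lam M, r => lam (M.rename (up r))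
  | app M N, r => app (M.rename r) (N.rename r)
  | sub M N, r => sub (M.rename (up r)) (N.rename r)
  | weak x M, r => weak (r x) (M.rename r)
  | contr x M, r => contr (r x) (M.rename (up (up r)))

/-- `M` seen in a scope with one more variable, the new variable being the index `0`. -/
def shift (M : Tm) : Tm := M.rename (fun n => n + 1)

/-- `M` seen in a scope with two more variables, the new ones being the indices `0` and `1`. -/
def shift2 (M : Tm) : Tm := M.rename (fun n => n + 2)

/-- Remove the bound index `0` from a set of variables. -/
def unbind (s : Finset ℕ) : Finset ℕ := (s.erase 0).image Nat.pred

/-- Free variables. -/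
def fv : Tm → Finset ℕ
  | var x => {x}
  | lam M => unbind M.fv
  | app M N => M.fv ∪ N.fv
  | sub M N => unbind M.fv ∪ N.fv
  | weak x M => insert x M.fv
  | contr x M =>
      if 0 ∈ M.fv ∨ 1 ∈ M.fv then insert x (unbind (unbind M.fv)) else unbind (unbind M.fv)

/-- Linear terms, i.e. the terms of `λlxr`. -/
def IsLinear : Tm → Prop
  | var _ => True
  | lam M => M.IsLinear ∧ 0 ∈ M.fv
  | app M N => M.IsLinear ∧ N.IsLinear ∧ Disjoint M.fv N.fv
  | sub M N => M.IsLinear ∧ N.IsLinear ∧ 0 ∈ M.fv ∧ Disjoint (unbind M.fv) N.fv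
  | weak x M => M.IsLinear ∧ x ∉ M.fv
  | contr x M => M.IsLinear ∧ 0 ∈ M.fv ∧ 1 ∈ M.fv ∧ x + 2 ∉ M.fv

/-- Pure `λ`-terms: no explicit substitution, weakening or contraction. -/
def IsPure : Tm → Prop
  | var _ => True
  | lam M => M.IsPure
  | app M N => M.IsPure ∧ N.IsPure
  | sub _ _ => False
  | weak _ _ => False
  | contr _ _ => False

/-- Terms of `λS`: no weakening or contraction. -/
def IsLS : Tm → Prop
  | var _ => True
  | lam M => M.IsLS
  | app M N => M.IsLS ∧ N.IsLS
  | sub M N => M.IsLS ∧ N.IsLS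
  | weak _ _ => False
  | contr _ _ => False

/-- Lift a substitution under one binder. -/
def upS (s : ℕ → Tm) : ℕ → Tm := scons (var 0) (fun n => (s n).shift)

/-- Implicit (meta-level, capture-avoiding) substitution. It is used on pure `λ`-terms only; the
values on `weak` and `contr` are irrelevant. -/
def subst : Tm → (ℕ → Tm) → Tm
  | var x, s => s x
  | lam M, s => lam (M.subst (upS s))
  | app M N, s => app (M.subst s) (N.subst s)
  | sub M N, s => sub (M.subst (upS s)) (N.subst s)
  | weak x M, s => weak x (M.subst s)
  | contr x M, s => contr x (M.subst (upS (upS s)))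

/-- `M{x := N}` where `x` is the index `0` of `M`. -/
def inst (M N : Tm) : Tm := M.subst (scons N var)

end Tm

open Tm

/-! ### Rewriting -/

/-- Closure of a set of rules under all term constructors. -/
inductive Cong (R : Tm → Tm → Prop) : Tm → Tm → Prop
  | rule {M M' : Tm} : R M M' → Cong R M M'
  | lam {M M' : Tm} : Cong R M M' → Cong R (lam M) (lam M')
  | appL {M M' N : Tm} : Cong R M M' → Cong R (app M N) (app M' N)
  | appR {M N N' : Tm} : Cong R N N' → Cong R (app M N) (app M N')
  | subL {M M' N : Tm} : Cong R M M' → Cong R (sub M N) (sub M' N)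
  | subR {M N N' : Tm} : Cong R N N' → Cong R (sub M N) (sub M N')
  | weak {x : ℕ} {M M' : Tm} : Cong R M M' → Cong R (weak x M) (weak x M')
  | contr {x : ℕ} {M M' : Tm} : Cong R M M' → Cong R (contr x M) (contr x M')

/-- Rewriting with the rules `R`, in any context, modulo the congruence generated by `E`. -/
def RedMod (R E : Tm → Tm → Prop) (M M' : Tm) : Prop :=
  ∃ P Q, Relation.EqvGen (Cong E) M P ∧ Cong R P Q ∧ Relation.EqvGen (Cong E) Q M'

/-- `M` is strongly normalising: there is no infinite reduction sequence from `M`. -/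
def SN (red : Tm → Tm → Prop) (M : Tm) : Prop := Acc (fun a b => red b a) M

/-- `β`-reduction at the root, on pure `λ`-terms. -/
inductive BetaRule : Tm → Tm → Prop
  | beta {M N : Tm} : M.IsPure → N.IsPure → BetaRule (app (lam M) N) (M.inst N)

/-- Exchange the indices `0` and `1`. -/
def swap01 (n : ℕ) : ℕ := Equiv.swap 0 1 n

/-- Reduction rules of `λS`. A subterm that does not contain the variable of an explicit
substitution, or that is moved under a binder, is written as a `shift` (or renaming) of a term of
the smaller scope. -/
inductive LSRule : Tm → Tm → Prop
  /-- `(λx.M) N → M[x:=N]` -/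
  | B {M N : Tm} : LSRule (app (lam M) N) (sub M N)
  /-- `y[x:=N] → y`, `x ≠ y` -/
  | W {y : ℕ} {N : Tm} : LSRule (sub (var (y + 1)) N) (var y)
  /-- `x[x:=N] → N` -/
  | SR {N : Tm} : LSRule (sub (var 0) N) N
  /-- `(M₁ M₂)[x:=N] → M₁[x:=N] M₂[x:=N]`, `x ∈ fv M₁`, `x ∈ fv M₂` -/
  | app₁ {M₁ M₂ N : Tm} : 0 ∈ M₁.fv → 0 ∈ M₂.fv →
      LSRule (sub (app M₁ M₂) N) (app (sub M₁ N) (sub M₂ N))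
  /-- `(M₁ M₂)[x:=N] → M₁ (M₂[x:=N])`, `x ∉ fv M₁`, `x ∈ fv M₂` -/
  | app₂ {M₁ M₂ N : Tm} : 0 ∈ M₂.fv →
      LSRule (sub (app M₁.shift M₂) N) (app M₁ (sub M₂ N))
  /-- `(M₁ M₂)[x:=N] → (M₁[x:=N]) M₂`, `x ∉ fv M₂` -/
  | app₃ {M₁ M₂ N : Tm} : LSRule (sub (app M₁ M₂.shift) N) (app (sub M₁ N) M₂)
  /-- `(λy.M)[x:=N] → λy.M[x:=N]`, `x ≠ y`, `y ∉ fv N` -/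
  | lam {M N : Tm} : LSRule (sub (lam M) N) (lam (sub (M.rename swap01) N.shift))
  /-- `M₁[y:=M₂][x:=N] → M₁[x:=N][y:=M₂[x:=N]]`, `x ∈ fv M₁`, `x ∈ fv M₂`, `y ∉ fv N` -/
  | sub₁ {M₁ M₂ N : Tm} : 1 ∈ M₁.fv → 0 ∈ M₂.fv →
      LSRule (sub (sub M₁ M₂) N) (sub (sub (M₁.rename swap01) N.shift) (sub M₂ N))
  /-- `M₁[y:=M₂][x:=N] → M₁[y:=M₂[x:=N]]`, `x ∉ fv M₁`, `x ∈ fv M₂` -/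
  | sub₂ {M₁ M₂ N : Tm} : 0 ∈ M₂.fv →
      LSRule (sub (sub (M₁.rename (up (fun n => n + 1))) M₂) N) (sub M₁ (sub M₂ N))

/-- Equivalence rule of `λS`. -/
inductive LSEq : Tm → Tm → Prop
  /-- `M[x:=N₁][y:=N₂] ≡ M[y:=N₂][x:=N₁]`, `x ≠ y`, `x ∉ fv N₂`, `y ∉ fv N₁` -/
  | CS {M N₁ N₂ : Tm} : LSEq (sub (sub M N₁.shift) N₂) (sub (sub (M.rename swap01) N₂.shift) N₁)

/-- `W_X(M)` for a list `X` of variables. -/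
def weakList (X : List ℕ) (M : Tm) : Tm := X.foldr weak M

/-- `C_X^{Y,Z}(M)` for a list `X` of variables: in `M`, the `i`-th elements of `Y` and `Z` are the
indices `2 * i` and `2 * i + 1`, and an outer variable `v` is the index `v + 2 * X.length`. -/
def contrList : List ℕ → Tm → Tm
  | [], M => M
  | x :: X, M => contrList X (contr (x + 2 * X.length) M)

/-- The renaming of `X` to `Y` inside `C_X^{Y,Z}( )`. -/
def toY (X : List ℕ) (v : ℕ) : ℕ := if v ∈ X then 2 * X.idxOf v else v + 2 * X.length

/-- The renaming of `X` to `Z` inside `C_X^{Y,Z}( )`. -/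
def toZ (X : List ℕ) (v : ℕ) : ℕ := if v ∈ X then 2 * X.idxOf v + 1 else v + 2 * X.length

/-- `(x, y, z) ↦ (y, z, x)`: a variable `x` bound inside the binder of `y, z` is moved outside. -/
def rotOut (n : ℕ) : ℕ := if n = 0 then 2 else if n = 1 then 0 else if n = 2 then 1 else n

/-- `(y, z, x) ↦ (x, y, z)`: a variable `x` bound outside the binder of `y, z` is moved inside. -/
def rotIn (n : ℕ) : ℕ := if n = 0 then 1 else if n = 1 then 2 else if n = 2 then 0 else n

/-- Exchange the pairs of indices `0, 1` and `2, 3`. -/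
def swapPairs (n : ℕ) : ℕ :=
  if n = 0 then 2 else if n = 1 then 3 else if n = 2 then 0 else if n = 3 then 1 else n

/-- Reduction rules of `λlxr` (used on linear terms). Moving a substitution under a contraction of
another variable is the equivalence `LxrEq.CSC`; it is not a reduction as well, which would make
reduction modulo equivalence loop. -/
inductive LxrRule : Tm → Tm → Prop
  /-- `(λx.M) N → M[x:=N]` -/
  | B {M N : Tm} : LxrRule (app (lam M) N) (sub M N)
  /-- `x[x:=N] → N` -/
  | SR {N : Tm} : LxrRule (sub (var 0) N) N
  /-- `(M₁ M₂)[x:=N] → (M₁[x:=N]) M₂`, `x ∈ fv M₁` -/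
  | SPapp₁ {M₁ M₂ N : Tm} : 0 ∈ M₁.fv → LxrRule (sub (app M₁ M₂.shift) N) (app (sub M₁ N) M₂)
  /-- `(M₁ M₂)[x:=N] → M₁ (M₂[x:=N])`, `x ∈ fv M₂` -/
  | SPapp₂ {M₁ M₂ N : Tm} : 0 ∈ M₂.fv → LxrRule (sub (app M₁.shift M₂) N) (app M₁ (sub M₂ N))
  /-- `(λy.M)[x:=N] → λy.M[x:=N]`, `x ≠ y`, `y ∉ fv N` -/
  | SPlam {M N : Tm} : LxrRule (sub (lam M) N) (lam (sub (M.rename swap01) N.shift))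
  /-- `W_y(M)[x:=N] → W_y(M[x:=N])`, `x ≠ y` -/
  | SPweak {y : ℕ} {M N : Tm} : LxrRule (sub (weak (y + 1) M) N) (weak y (sub M N))
  /-- `W_x(M)[x:=N] → W_{fv N}(M)` -/
  | W {M N : Tm} {X : List ℕ} : X.Nodup → X.toFinset = N.fv →
      LxrRule (sub (weak 0 M.shift) N) (weakList X M)
  /-- `C_x^{y,z}(M)[x:=N] → C_X^{Y,Z}(M[y:=N₁][z:=N₂])`, `X = fv N`, `N₁` and `N₂` the renamings
  of `N` from `X` to the fresh `Y` and `Z` -/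
  | D {M N : Tm} {X : List ℕ} : X.Nodup → X.toFinset = N.fv →
      LxrRule (sub (contr 0 (M.rename (up (up (fun n => n + 1))))) N)
        (contrList X
          (sub (sub (M.rename (up (up (fun n => n + 2 * X.length)))) (N.rename (toY X)).shift)
            (N.rename (toZ X))))
  /-- `M₁[y:=M₂][x:=N] → M₁[y:=M₂[x:=N]]`, `x ∈ fv M₂` -/
  | comp {M₁ M₂ N : Tm} : 0 ∈ M₂.fv →
      LxrRule (sub (sub (M₁.rename (up (fun n => n + 1))) M₂) N) (sub M₁ (sub M₂ N))
  /-- `λx.W_y(M) → W_y(λx.M)`, `x ≠ y` -/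
  | WAbs {y : ℕ} {M : Tm} : LxrRule (lam (weak (y + 1) M)) (weak y (lam M))
  /-- `W_y(M) N → W_y(M N)` -/
  | WApp₁ {y : ℕ} {M N : Tm} : LxrRule (app (weak y M) N) (weak y (app M N))
  /-- `M W_y(N) → W_y(M N)` -/
  | WApp₂ {y : ℕ} {M N : Tm} : LxrRule (app M (weak y N)) (weak y (app M N))
  /-- `M[x:=W_y(N)] → W_y(M[x:=N])` -/
  | WSubs {y : ℕ} {M N : Tm} : LxrRule (sub M (weak y N)) (weak y (sub M N))
  /-- `C_w^{y,z}(W_y(M)) → M` with `z` renamed to `w` -/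
  | Merge {w : ℕ} {M : Tm} : LxrRule (contr w (weak 0 M.shift)) (M.rename (scons w id))
  /-- `C_w^{y,z}(W_x(M)) → W_x(C_w^{y,z}(M))`, `x ≠ y`, `x ≠ z` -/
  | Cross {w x : ℕ} {M : Tm} : LxrRule (contr w (weak (x + 2) M)) (weak x (contr w M))
  /-- `C_w^{y,z}(λx.M) → λx.C_w^{y,z}(M)` -/
  | CAbs {w : ℕ} {M : Tm} : LxrRule (contr w (lam M)) (lam (contr (w + 1) (M.rename rotOut)))
  /-- `C_w^{y,z}(M N) → C_w^{y,z}(M) N`, `y, z ∈ fv M` -/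
  | CApp₁ {w : ℕ} {M N : Tm} : 0 ∈ M.fv → 1 ∈ M.fv →
      LxrRule (contr w (app M N.shift2)) (app (contr w M) N)
  /-- `C_w^{y,z}(M N) → M C_w^{y,z}(N)`, `y, z ∈ fv N` -/
  | CApp₂ {w : ℕ} {M N : Tm} : 0 ∈ N.fv → 1 ∈ N.fv →
      LxrRule (contr w (app M.shift2 N)) (app M (contr w N))
  /-- `C_w^{y,z}(M[x:=N]) → M[x:=C_w^{y,z}(N)]`, `y, z ∈ fv N` -/
  | CSubs {w : ℕ} {M N : Tm} : 0 ∈ N.fv → 1 ∈ N.fv →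
      LxrRule (contr w (sub (M.rename (up (fun n => n + 2))) N)) (sub M (contr w N))

/-- Equivalence rules of `λlxr` (used on linear terms). -/
inductive LxrEq : Tm → Tm → Prop
  /-- `C_w^{x,v}(C_x^{z,y}(M)) ≡ C_w^{x,y}(C_x^{z,v}(M))`, `x ≠ y, v` -/
  | CA {w : ℕ} {M : Tm} : LxrEq (contr w (contr 0 M)) (contr w (contr 0 (M.rename (fun n => Equiv.swap 1 3 n))))
  /-- `C_x^{y,z}(M) ≡ C_x^{z,y}(M)` -/
  | CC {x : ℕ} {M : Tm} : LxrEq (contr x M) (contr x (M.rename swap01))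
  /-- `C_{x'}^{y',z'}(C_x^{y,z}(M)) ≡ C_x^{y,z}(C_{x'}^{y',z'}(M))`, `x ≠ y', z'`, `x' ≠ y, z` -/
  | CCC {x x' : ℕ} {M : Tm} :
      LxrEq (contr x' (contr (x + 2) M)) (contr x (contr (x' + 2) (M.rename swapPairs)))
  /-- `W_x(W_y(M)) ≡ W_y(W_x(M))` -/
  | WW {x y : ℕ} {M : Tm} : LxrEq (weak x (weak y M)) (weak y (weak x M))
  /-- `M[x:=N₁][y:=N₂] ≡ M[y:=N₂][x:=N₁]`, `y ∉ fv N₁`, `x ∉ fv N₂` -/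
  | CS {M N₁ N₂ : Tm} : LxrEq (sub (sub M N₁.shift) N₂) (sub (sub (M.rename swap01) N₂.shift) N₁)
  /-- `C_w^{y,z}(M)[x:=N] ≡ C_w^{y,z}(M[x:=N])`, `x ≠ w`, `y, z ∉ fv N` -/
  | CSC {w : ℕ} {M N : Tm} :
      LxrEq (sub (contr (w + 1) M) N) (contr w (sub (M.rename rotIn) N.shift2))

/-- `SN_λ` -/
def SNLambda : Tm → Prop := SN (Cong BetaRule)

/-- `SN_λS` -/
def SNLS : Tm → Prop := SN (RedMod LSRule LSEq)

/-- `SN_λlxr` -/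
def SNLxr : Tm → Prop := SN (RedMod LxrRule LxrEq)

/-! ### Non-idempotent intersection types -/

mutual
/-- `F`-types: `F ::= τ | A → F`. -/
inductive FTy : Type
  | atom (τ : ℕ) : FTy
  | arr (A : ATy) (F : FTy) : FTy
/-- `A`-types: `A ::= F | A ∩ B`. -/
inductive ATy : Type
  | ofF (F : FTy) : ATy
  | inter (A B : ATy) : ATy
end

/-- `U`-types: `U ::= A | ω`; `none` is the empty type `ω`. -/
abbrev UTy : Type := Option ATy

/-- Intersection of `U`-types, with `ω` neutral. -/
def UTy.inter : UTy → UTy → UTy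
  | some A, some B => some (ATy.inter A B)
  | some A, none => some A
  | none, V => V

/-- `A ≈ B`: associativity and commutativity of `∩`, not underneath arrows. -/
inductive AEqv : ATy → ATy → Prop
  | refl (F : FTy) : AEqv (.ofF F) (.ofF F)
  | comm (A B : ATy) : AEqv (.inter A B) (.inter B A)
  | congr {A A' B B' : ATy} : AEqv A A' → AEqv B B' → AEqv (.inter A B) (.inter A' B')
  | trans {A B C : ATy} : AEqv A B → AEqv B C → AEqv A C
  | assoc (A B C : ATy) : AEqv (.inter (.inter A B) C) (.inter A (.inter B C))
  | assoc' (A B C : ATy) : AEqv (.inter A (.inter B C)) (.inter (.inter A B) C)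

/-- `U ≈ V` -/
def UEqv : UTy → UTy → Prop
  | some A, some B => AEqv A B
  | none, none => True
  | _, _ => False

/-- `U ⊆ V` iff `U ≈ V ∩ U'` for some `U'`. -/
def USub (U V : UTy) : Prop := ∃ U', UEqv U (UTy.inter V U')

/-- Typing contexts: total maps from variables to `U`-types. (The contexts of derivable judgements
have a finite domain, see `Typ.finite_dom`.) -/
abbrev Ctx : Type := ℕ → UTy

/-- Pointwise intersection of contexts. -/
def Ctx.inter (Γ Δ : Ctx) : Ctx := fun x => UTy.inter (Γ x) (Δ x)

/-- The context `x : U`. -/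
def Ctx.single (x : ℕ) (U : UTy) : Ctx := fun y => if y = x then U else none

/-- Derivability `Γ ⊢∩ M : U`. A context `Γ, x : U` in which `x` is the variable of a binder is
`scons U Γ`; the context `Γ, x : U ∩ V` obtained from `Γ, x : U` is its intersection with `x : V`. -/
inductive Typ : Ctx → Tm → UTy → Prop
  | var (x : ℕ) (F : FTy) : Typ (Ctx.single x (some (.ofF F))) (var x) (some (.ofF F))
  | abs {Γ : Ctx} {U : UTy} {M : Tm} {A : ATy} {F : FTy} :
      Typ (scons U Γ) M (some (.ofF F)) → USub (some A) U →
      Typ Γ (lam M) (some (.ofF (.arr A F)))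
  | app {Γ Δ : Ctx} {M N : Tm} {A : ATy} {F : FTy} :
      Typ Γ M (some (.ofF (.arr A F))) → Typ Δ N (some A) →
      Typ (Γ.inter Δ) (app M N) (some (.ofF F))
  | inter {Γ Δ : Ctx} {M : Tm} {A B : ATy} :
      Typ Γ M (some A) → Typ Δ M (some B) → Typ (Γ.inter Δ) M (some (.inter A B))
  | omega (M : Tm) : Typ (fun _ => none) M none
  | sub {Γ Δ : Ctx} {M N : Tm} {A : ATy} {U : UTy} {F : FTy} :
      Typ Γ N (some A) → Typ (scons U Δ) M (some (.ofF F)) → (U = some A ∨ U = none) →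
      Typ (Γ.inter Δ) (sub M N) (some (.ofF F))
  | contr {Γ : Ctx} {x : ℕ} {V₁ V₂ : UTy} {M : Tm} {F : FTy} :
      Typ (scons V₁ (scons V₂ Γ)) M (some (.ofF F)) →
      Typ (Γ.inter (Ctx.single x (UTy.inter V₁ V₂))) (contr x M) (some (.ofF F))
  | weak {Γ : Ctx} {x : ℕ} {A : ATy} {M : Tm} {F : FTy} :
      Typ Γ M (some (.ofF F)) →
      Typ (Γ.inter (Ctx.single x (some A))) (weak x M) (some (.ofF F))

/-! ### I-filters and the interpretation of terms -/

/-- I-filters. -/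
@[ext] structure IFilter : Type where
  carrier : Set ATy
  inter_mem : ∀ {A B : ATy}, A ∈ carrier → B ∈ carrier → ATy.inter A B ∈ carrier
  sub_mem : ∀ {A B : ATy}, A ∈ carrier → USub (some A) (some B) → B ∈ carrier

instance : Membership ATy IFilter := ⟨fun v A => A ∈ v.carrier⟩

/-- The empty I-filter. -/
instance : Bot IFilter := ⟨⟨∅, fun h => h.elim, fun h => h.elim⟩⟩

/-- The I-filter of all `A`-types. -/
instance : Top IFilter := ⟨⟨Set.univ, fun _ _ => trivial, fun _ _ => trivial⟩⟩

/-- The smallest I-filter that contains a given set of `A`-types. -/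
def IFilter.gen (S : Set ATy) : IFilter where
  carrier := {A | ∀ v : IFilter, S ⊆ v.carrier → A ∈ v.carrier}
  inter_mem := fun hA hB v hv => v.inter_mem (hA v hv) (hB v hv)
  sub_mem := fun hA h v hv => v.sub_mem (hA v hv) h

/-- Application `u @ v` of I-filters. -/
def IFilter.ap (u v : IFilter) : IFilter :=
  IFilter.gen {B | ∃ F : FTy, B = .ofF F ∧ ∃ A, A ∈ v ∧ ATy.ofF (.arr A F) ∈ u}

/-- Values: non-empty I-filters. -/
abbrev Value : Type := {u : IFilter // u ≠ ⊥}

/-- Environments: maps from term variables to I-filters. -/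
abbrev Env : Type := ℕ → IFilter

/-- `Γ ∈ ρ` -/
def Compat (Γ : Ctx) (ρ : Env) : Prop := ∀ (x : ℕ) (A : ATy), Γ x = some A → A ∈ ρ x

theorem AEqv.rfl : (A : ATy) → AEqv A A
  | .ofF F => AEqv.refl F
  | .inter A B => AEqv.congr (AEqv.rfl A) (AEqv.rfl B)

theorem IFilter.mem_inter {v : IFilter} {A B : ATy} : ATy.inter A B ∈ v ↔ A ∈ v ∧ B ∈ v :=
  ⟨fun h => ⟨v.sub_mem h ⟨some B, AEqv.rfl _⟩, v.sub_mem h ⟨some A, AEqv.comm _ _⟩⟩,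
    fun h => v.inter_mem h.1 h.2⟩

theorem Compat.inter_iff {Γ Δ : Ctx} {ρ : Env} :
    Compat (Γ.inter Δ) ρ ↔ Compat Γ ρ ∧ Compat Δ ρ := by
  have key : ∀ x, (∀ A, Γ.inter Δ x = some A → A ∈ ρ x) ↔
      (∀ A, Γ x = some A → A ∈ ρ x) ∧ (∀ A, Δ x = some A → A ∈ ρ x) := by
    intro x
    unfold Ctx.inter
    rcases Γ x with _ | A <;> rcases Δ x with _ | B <;> simp [UTy.inter, IFilter.mem_inter]
  unfold Compat
  rw [← forall_and]
  exact forall_congr' key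

theorem Typ.inter_inv {Γ : Ctx} {M : Tm} {A B : ATy} (h : Typ Γ M (some (.inter A B))) :
    ∃ Γ₁ Γ₂, Γ = Ctx.inter Γ₁ Γ₂ ∧ Typ Γ₁ M (some A) ∧ Typ Γ₂ M (some B) := by
  cases h with
  | inter h₁ h₂ => exact ⟨_, _, rfl, h₁, h₂⟩

theorem Typ.of_eqv {ρ : Env} {M : Tm} {A B : ATy} (h : AEqv A B) :
    (∃ Γ, Compat Γ ρ ∧ Typ Γ M (some A)) → ∃ Γ, Compat Γ ρ ∧ Typ Γ M (some B) := by
  have split : ∀ {A B : ATy}, (∃ Γ, Compat Γ ρ ∧ Typ Γ M (some (.inter A B))) ↔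
      (∃ Γ, Compat Γ ρ ∧ Typ Γ M (some A)) ∧ ∃ Γ, Compat Γ ρ ∧ Typ Γ M (some B) := by
    intro A B
    constructor
    · rintro ⟨Γ, hΓ, h⟩
      obtain ⟨Γ₁, Γ₂, rfl, h₁, h₂⟩ := h.inter_inv
      exact ⟨⟨_, (Compat.inter_iff.1 hΓ).1, h₁⟩, ⟨_, (Compat.inter_iff.1 hΓ).2, h₂⟩⟩
    · rintro ⟨⟨Γ₁, c₁, h₁⟩, ⟨Γ₂, c₂, h₂⟩⟩
      exact ⟨_, Compat.inter_iff.2 ⟨c₁, c₂⟩, h₁.inter h₂⟩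
  induction h with
  | refl F => exact id
  | comm A B => rw [split, split]; exact And.symm
  | congr _ _ ih₁ ih₂ => rw [split, split]; exact fun h => ⟨ih₁ h.1, ih₂ h.2⟩
  | trans _ _ ih₁ ih₂ => exact ih₂ ∘ ih₁
  | assoc A B C => simp only [split]; exact fun h => ⟨h.1.1, h.1.2, h.2⟩
  | assoc' A B C => simp only [split]; exact fun h => ⟨⟨h.1, h.2.1⟩, h.2.2⟩

/-- The interpretation `⟦M⟧_ρ = {A | ∃ Γ ∈ ρ, Γ ⊢∩ M : A}`. -/
def interp (M : Tm) (ρ : Env) : IFilter where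
  carrier := {A | ∃ Γ, Compat Γ ρ ∧ Typ Γ M (some A)}
  inter_mem := by
    rintro A B ⟨Γ₁, c₁, h₁⟩ ⟨Γ₂, c₂, h₂⟩
    exact ⟨_, Compat.inter_iff.2 ⟨c₁, c₂⟩, h₁.inter h₂⟩
  sub_mem := by
    rintro A B hA ⟨U, hU⟩
    rcases U with _ | C
    · exact Typ.of_eqv hU hA
    · obtain ⟨Γ, c, h⟩ := Typ.of_eqv (B := .inter B C) hU hA
      obtain ⟨Γ₁, Γ₂, rfl, h₁, -⟩ := h.inter_inv
      exact ⟨_, (Compat.inter_iff.1 c).1, h₁⟩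

theorem Typ.finite_dom {Γ : Ctx} {M : Tm} {U : UTy} (h : Typ Γ M U) :
    {x | Γ x ≠ none}.Finite := by
  have hinter : ∀ {Γ Δ : Ctx}, {x | Γ x ≠ none}.Finite → {x | Δ x ≠ none}.Finite →
      {x | Γ.inter Δ x ≠ none}.Finite := by
    intro Γ Δ h₁ h₂
    refine (h₁.union h₂).subset fun x hx => ?_
    by_contra hc
    simp only [Set.mem_union, Set.mem_ofPred_eq, not_or, not_not] at hc
    exact hx (by simp [Ctx.inter, hc.1, hc.2, UTy.inter])
  have hsingle : ∀ (x : ℕ) (U : UTy), {y | Ctx.single x U y ≠ none}.Finite := by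
    intro x U
    refine (Set.finite_singleton x).subset fun y hy => ?_
    by_contra hc
    exact hy (by simp [Ctx.single, show y ≠ x from hc])
  have htail : ∀ {U : UTy} {Γ : Ctx}, {x | scons U Γ x ≠ none}.Finite →
      {x | Γ x ≠ none}.Finite := by
    intro U Γ h
    exact h.preimage (f := Nat.succ) (Set.injOn_of_injective Nat.succ_injective)
  induction h with
  | var x F => exact hsingle _ _
  | abs _ _ ih => exact htail ih
  | app _ _ ih₁ ih₂ => exact hinter ih₁ ih₂
  | inter _ _ ih₁ ih₂ => exact hinter ih₁ ih₂
  | omega => simp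
  | sub _ _ _ ih₁ ih₂ => exact hinter ih₁ (htail ih₂)
  | contr _ ih => exact hinter (htail (htail ih)) (hsingle _ _)
  | weak _ ih => exact hinter ih (hsingle _ _)

/-! ### The source system `S` -/

/-- Types of System `S`: `𝔄 ::= α | 𝔄 → 𝔅 | 𝔄 ∩ 𝔅 | ∀α.𝔄`, type variables being de Bruijn indices
(`all` binds the index `0`). -/
inductive STy : Type
  | tvar (α : ℕ) : STy
  | arr (A B : STy) : STy
  | inter (A B : STy) : STy
  | all (A : STy) : STy

namespace STy

/-- Renaming of the free type variables (capture-avoiding). -/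
def rename : STy → (ℕ → ℕ) → STy
  | tvar α, r => tvar (r α)
  | arr A B, r => arr (A.rename r) (B.rename r)
  | inter A B, r => inter (A.rename r) (B.rename r)
  | all A, r => all (A.rename (up r))

/-- The type in a scope with one more type variable, the index `0`. -/
def shift (A : STy) : STy := A.rename (fun n => n + 1)

/-- Substitution of types for type variables (capture-avoiding). -/
def subst : STy → (ℕ → STy) → STy
  | tvar α, s => s α
  | arr A B, s => arr (A.subst s) (B.subst s)
  | inter A B, s => inter (A.subst s) (B.subst s)
  | all A, s => all (A.subst (scons (tvar 0) (fun n => (s n).shift)))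

/-- `𝔄{α := 𝔅}` where `α` is the index `0` of `𝔄`. -/
def inst (A B : STy) : STy := A.subst (scons B tvar)

end STy

/-- Contexts of System `S`: partial maps from term variables to types. -/
abbrev SCtx : Type := ℕ → Option STy

/-- Derivability `𝚪 ⊢_S M : 𝔄`. The side condition `α ∉ TV(𝚪)` of the introduction of `∀` is
expressed by shifting the type variables of `𝚪`. -/
inductive STyp : SCtx → Tm → STy → Prop
  | var {Γ : SCtx} {x : ℕ} {A : STy} : Γ x = some A → STyp Γ (var x) A
  | abs {Γ : SCtx} {M : Tm} {A B : STy} : STyp (scons (some A) Γ) M B → STyp Γ (lam M) (.arr A B)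
  | app {Γ : SCtx} {M N : Tm} {A B : STy} :
      STyp Γ M (.arr A B) → STyp Γ N A → STyp Γ (app M N) B
  | interI {Γ : SCtx} {M : Tm} {A B : STy} : STyp Γ M A → STyp Γ M B → STyp Γ M (.inter A B)
  | interE₁ {Γ : SCtx} {M : Tm} {A B : STy} : STyp Γ M (.inter A B) → STyp Γ M A
  | interE₂ {Γ : SCtx} {M : Tm} {A B : STy} : STyp Γ M (.inter A B) → STyp Γ M B
  | allI {Γ : SCtx} {M : Tm} {A : STy} :
      STyp (fun x => (Γ x).map STy.shift) M A → STyp Γ M (.all A)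
  | allE {Γ : SCtx} {M : Tm} {A B : STy} : STyp Γ M (.all A) → STyp Γ M (A.inst B)
  | sub {Γ : SCtx} {M N : Tm} {A B : STy} :
      STyp Γ N A → STyp (scons (some A) Γ) M B → STyp Γ (sub M N) B
  | weak {Γ : SCtx} {x : ℕ} {M : Tm} {A B : STy} :
      STyp Γ M B → Γ x = none → STyp (Function.update Γ x (some A)) (weak x M) B
  | contr {Γ : SCtx} {x : ℕ} {M : Tm} {A B : STy} :
      STyp (scons (some A) (scons (some A) Γ)) M B → Γ x = none →
      STyp (Function.update Γ x (some A)) (contr x M) B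

/-! ### The orthogonality model of I-filters -/

/-- `u @ v₁ @ ⋯ @ vₙ` -/
def apList (u : IFilter) (vs : List Value) : IFilter := vs.foldl (fun w v => w.ap v.1) u

/-- Orthogonality: `u ⊥ (v₁, …, vₙ)` iff `u @ v₁ @ ⋯ @ vₙ` is a value. -/
def Orth (u : Value) (vs : List Value) : Prop := apList u.1 vs ≠ ⊥

/-- The values that are orthogonal to all elements of a set of lists of values. -/
def orthSet (Y : Set (List Value)) : Set Value := {u | ∀ vs ∈ Y, Orth u vs}

/-- Valuations: maps from type variables to non-empty sets of lists of values. (The orthogonal of the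
empty set would contain every value, so that a function of type `α → α` could be applied to a value
with an empty result.) -/
abbrev Valuation : Type := ℕ → {Y : Set (List Value) // Y.Nonempty}

/-- The negative interpretation `⟦𝔄⟧⁻_σ` of a type, a set of lists of values. -/
def semN : STy → Valuation → Set (List Value)
  | .tvar α, σ => (σ α).1
  | .arr A B, σ => {l | ∃ u ∈ orthSet (semN A σ), ∃ vs ∈ semN B σ, l = u :: vs}
  | .inter A B, σ => semN A σ ∪ semN B σ
  | .all A, σ => ⋃ Y : {Y : Set (List Value) // Y.Nonempty}, semN A (scons Y σ)

/-- The positive interpretation `⟦𝔄⟧_σ`, the orthogonal of the negative one. -/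
def semP (A : STy) (σ : Valuation) : Set Value := orthSet (semN A σ)

/-- `ρ ∈ ⟦𝚪⟧_σ`: for every `x : 𝔄` in `𝚪`, `ρ(x)` is a value in `⟦𝔄⟧_σ`. -/
def CtxSem (Γ : SCtx) (σ : Valuation) : Set Env :=
  {ρ | ∀ (x : ℕ) (A : STy), Γ x = some A → ∃ u ∈ semP A σ, ρ x = u.1}

end ESub

-- The proof has two halves, joined by non-idempotent intersection types: an orthogonality model
-- turns a typing in System `S` into an intersection typing, and the resources counted by an
-- intersection typing bound all reductions.
--
-- Orthogonality. A filter that gives a value on some list of arguments is itself a value, and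
-- negative interpretations are never empty because valuations take non-empty sets. Hence adequacy
-- (`STyp.adequacy`), which says that the interpretation of `M` is orthogonal to the negative
-- interpretation of its type, makes that interpretation non-empty. Only inclusions between filters
-- are needed, since orthogonality to a fixed list is upward closed. In the environment constantly
-- equal to `⊤`, which realises every context, non-emptiness is an intersection typing of `M`.
--
-- Resources. Modulo associativity and commutativity an `A`-type is a non-empty multiset of
-- `F`-types, and a derivation becomes a syntax-directed typing `QTyp` in which every argument is
-- typed, even when it will be erased. An application to an argument typed by `A` costs `|A|`, an
-- explicit substitution only `|A| - 1`. Firing a redex therefore gains one. Distributing a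
-- substitution over two subterms that both use it splits the typings of the argument between the
-- copies and gains as well, because each copy has its own discount of one. Erasure by
-- `W_x(M)[x:=N]` discards a positive cost. All the other rules do not increase the cost and
-- strictly decrease the polynomial `Tm.rk`; the equivalences preserve both. Strong normalisation in
-- `λS` and `λlxr` is then a lexicographic induction (`QTyp.sn`). Side conditions on free variables
-- enter through `QTyp.ne_zero`: a typed term gives each of its free variables a non-empty multiset,
-- so every copy of a substitution has something to type.
--
-- For pure terms, a `β`-step is simulated by at least one step of `λS`.

namespace ESub

open Tm

/-! ### Quantitative contexts -/

/-- Contexts that map every variable to a multiset of `F`-types. -/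
abbrev MCtx : Type := ℕ → Multiset FTy

/-- The context with a single declaration. -/
abbrev MCtx.single (x : ℕ) (V : Multiset FTy) : MCtx := Pi.single x V

@[simp] theorem scons_zero {α : Type*} (a : α) (f : ℕ → α) : scons a f 0 = a := rfl

@[simp] theorem scons_succ {α : Type*} (a : α) (f : ℕ → α) (n : ℕ) : scons a f (n + 1) = f n := rfl

@[simp] theorem scons_one {α : Type*} (a : α) (f : ℕ → α) : scons a f 1 = f 0 := rfl

theorem scons_eta {α : Type*} (f : ℕ → α) : scons (f 0) (fun x => f (x + 1)) = f := by
  funext x; cases x <;> rfl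

theorem exists_eq_scons {α : Type*} (f : ℕ → α) : ∃ a g, f = scons a g :=
  ⟨_, _, (scons_eta f).symm⟩

theorem scons_inj {α : Type*} {a b : α} {f g : ℕ → α} (h : scons a f = scons b g) :
    a = b ∧ f = g :=
  ⟨congrFun h 0, funext fun x => congrFun h (x + 1)⟩

theorem scons_add {α : Type*} [Add α] (a b : α) (f g : ℕ → α) :
    scons (a + b) (f + g) = scons a f + scons b g := by
  funext x; cases x <;> rfl

theorem scons_zero_zero {α : Type*} [Zero α] : scons (0 : α) 0 = 0 := by
  funext x; cases x <;> rfl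

/-- Inverts a splitting of a context below a binder; used whenever a rule moves a construct through
an application or a substitution. -/
theorem scons_eq_add {α : Type*} [Add α] {a : α} {f g h : ℕ → α} (e : scons a f = g + h) :
    ∃ a₁ a₂ f₁ f₂, g = scons a₁ f₁ ∧ h = scons a₂ f₂ ∧ a = a₁ + a₂ ∧ f = f₁ + f₂ := by
  obtain ⟨a₁, f₁, rfl⟩ := exists_eq_scons g
  obtain ⟨a₂, f₂, rfl⟩ := exists_eq_scons h
  rw [← scons_add] at e
  obtain ⟨rfl, rfl⟩ := scons_inj e
  exact ⟨_, _, _, _, rfl, rfl, rfl, rfl⟩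

theorem MCtx.single_zero_eq_scons (V : Multiset FTy) : MCtx.single 0 V = scons V 0 := by
  funext x; cases x <;> simp

theorem MCtx.single_succ_eq_scons (x : ℕ) (V : Multiset FTy) :
    MCtx.single (x + 1) V = scons 0 (MCtx.single x V) := by
  funext y; cases y <;> simp [Pi.single_apply]

/-! ### Sums of derivations -/

/-- `Multi P Γ S n`: the types of `S` are derived by `P`, with contexts that add up to at most `Γ`
and measures that add up to at most `n`. -/
inductive Multi (P : MCtx → FTy → ℕ → Prop) : MCtx → Multiset FTy → ℕ → Prop
  | zero (Γ : MCtx) (n : ℕ) : Multi P Γ 0 n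
  | cons {Γ Δ : MCtx} {F : FTy} {S : Multiset FTy} {m n : ℕ} :
      P Γ F m → Multi P Δ S n → Multi P (Γ + Δ) (F ::ₘ S) (m + n)

namespace Multi

variable {P Q : MCtx → FTy → ℕ → Prop}

/-- The slack goes into the final `zero`, which accepts any context and any bound. -/
theorem mono {Γ : MCtx} {S : Multiset FTy} {n : ℕ} (h : Multi P Γ S n) (Δ : MCtx) {n' : ℕ}
    (hn : n ≤ n') : Multi P (Γ + Δ) S n' := by
  induction h generalizing n' with
  | zero Γ n => exact zero _ _
  | @cons Γ Θ F S m n h₁ _ ih =>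
    have := cons h₁ (ih (n' := n' - m) (by omega))
    rwa [← add_assoc, show m + (n' - m) = n' by omega] at this

theorem single {Γ : MCtx} {F : FTy} {n : ℕ} (h : P Γ F n) : Multi P Γ {F} n := by
  simpa using cons h (zero (0 : MCtx) 0)

theorem add {Γ Δ : MCtx} {S T : Multiset FTy} {m n : ℕ} (h : Multi P Γ S m) (h' : Multi P Δ T n) :
    Multi P (Γ + Δ) (S + T) (m + n) := by
  induction h with
  | zero Γ m => rw [zero_add, add_comm]; exact h'.mono _ (by omega)
  | cons h₁ _ ih => rw [add_assoc, add_assoc, Multiset.cons_add]; exact cons h₁ ih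

/-- A multiset has no preferred first element, so the equation `S = F ::ₘ T` is kept as a hypothesis
and the induction looks for `F` anywhere in the sum. -/
theorem erase {Γ : MCtx} {S : Multiset FTy} {n : ℕ} (h : Multi P Γ S n) :
    ∀ {F : FTy} {T : Multiset FTy}, S = F ::ₘ T →
    ∃ Γ₁ Γ₂ n₁ n₂, Γ = Γ₁ + Γ₂ ∧ n = n₁ + n₂ ∧ P Γ₁ F n₁ ∧ Multi P Γ₂ T n₂ := by
  induction h with
  | zero => intro F T e; exact absurd e.symm (Multiset.cons_ne_zero)
  | @cons Γ Δ G S m n h₁ h₂ ih =>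
    intro F T e
    rcases Multiset.cons_eq_cons.1 e with ⟨rfl, rfl⟩ | ⟨-, R, rfl, rfl⟩
    · exact ⟨_, _, _, _, rfl, rfl, h₁, h₂⟩
    · obtain ⟨Γ₁, Γ₂, n₁, n₂, rfl, rfl, k₁, k₂⟩ := ih rfl
      exact ⟨Γ₁, Γ + Γ₂, n₁, m + n₂, by abel, by omega, k₁, cons h₁ k₂⟩

theorem split {S T : Multiset FTy} : ∀ {Γ : MCtx} {n : ℕ}, Multi P Γ (S + T) n →
    ∃ Γ₁ Γ₂ n₁ n₂, Γ = Γ₁ + Γ₂ ∧ n = n₁ + n₂ ∧ Multi P Γ₁ S n₁ ∧ Multi P Γ₂ T n₂ := by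
  induction S using Multiset.induction_on with
  | empty => intro Γ n h; exact ⟨0, Γ, 0, n, by simp, by simp, zero _ _, by simpa using h⟩
  | cons F S ih =>
    intro Γ n h
    obtain ⟨Γ₁, Γ₂, n₁, n₂, rfl, rfl, k₁, k₂⟩ := h.erase (Multiset.cons_add _ _ _)
    obtain ⟨Γ₃, Γ₄, n₃, n₄, rfl, rfl, k₃, k₄⟩ := ih k₂
    exact ⟨_, _, _, _, (add_assoc _ _ _).symm, (add_assoc _ _ _).symm, cons k₁ k₃, k₄⟩

/-- Additivity of `φ` is what lets a transformation of single typings act on a sum of typings;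
renaming and contraction are both of this kind. -/
theorem map (φ : MCtx →+ MCtx) (hφ : ∀ Γ F n, P Γ F n → Q (φ Γ) F n) {Γ : MCtx}
    {S : Multiset FTy} {n : ℕ} (h : Multi P Γ S n) : Multi Q (φ Γ) S n := by
  induction h with
  | zero => exact zero _ _
  | cons h₁ _ ih => rw [map_add]; exact cons (hφ _ _ _ h₁) ih

theorem imp (hPQ : ∀ Γ F n, P Γ F n → Q Γ F n) {Γ : MCtx} {S : Multiset FTy} {n : ℕ}
    (h : Multi P Γ S n) : Multi Q Γ S n :=
  h.map (AddMonoidHom.id _) hPQ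

/-- A single strict decrease is enough, and a non-zero `S` provides a typing in which it occurs. -/
theorem imp_lt (hle : ∀ Γ F n, P Γ F n → Q Γ F n) (hlt : ∀ Γ F n, P Γ F n → ∃ k < n, Q Γ F k)
    {Γ : MCtx} {S : Multiset FTy} {n : ℕ} (h : Multi P Γ S n) (hS : S ≠ 0) :
    ∃ k < n, Multi Q Γ S k := by
  cases h with
  | zero => exact absurd rfl hS
  | cons h₁ h₂ =>
    obtain ⟨k, hk, h₁⟩ := hlt _ _ _ h₁
    exact ⟨_, by omega, cons h₁ (h₂.imp hle)⟩

end Multi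

/-! ### Quantitative typing -/

/-- The multiset of the `F`-types of which an `A`-type is the intersection. -/
def ATy.toM : ATy → Multiset FTy
  | .ofF F => {F}
  | .inter A B => A.toM + B.toM

theorem ATy.toM_ne_zero : ∀ A : ATy, A.toM ≠ 0
  | .ofF F => Multiset.singleton_ne_zero F
  | .inter A B => by simp [ATy.toM, ATy.toM_ne_zero A]

/-- Quantitative typing by `F`-types, with implicit weakening of the context. The number `n` bounds
a measure of the derivation that counts variables, the types of arguments, and the types of the
bodies of explicit substitutions but one. -/
def QTyp : Tm → MCtx → FTy → ℕ → Prop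
  | .var x, Γ, F, n => F ∈ Γ x ∧ 0 < n
  | .lam M, Γ, F, n => ∃ A G, F = .arr A G ∧ QTyp M (scons A.toM Γ) G n
  | .app M N, Γ, F, n => ∃ A Γ₁ Γ₂ n₁ n₂, Γ = Γ₁ + Γ₂ ∧ n₁ + n₂ + A.toM.card ≤ n ∧
      QTyp M Γ₁ (.arr A F) n₁ ∧ Multi (QTyp N) Γ₂ A.toM n₂
  | .sub M N, Γ, F, n => ∃ A Γ₁ Γ₂ n₁ n₂, A ≠ 0 ∧ Γ = Γ₁ + Γ₂ ∧
      n₁ + n₂ + A.card ≤ n + 1 ∧ QTyp M (scons A Γ₁) F n₁ ∧ Multi (QTyp N) Γ₂ A n₂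
  | .weak x M, Γ, F, n => Γ x ≠ 0 ∧ QTyp M Γ F n
  | .contr x M, Γ, F, n => ∃ V₁ V₂ Γ', V₁ ≠ 0 ∧ V₂ ≠ 0 ∧ Γ = Γ' + MCtx.single x (V₁ + V₂) ∧
      QTyp M (scons V₁ (scons V₂ Γ')) F n

theorem MCtx.ne_zero_add {Γ : MCtx} {x : ℕ} (h : Γ x ≠ 0) (Δ : MCtx) : (Γ + Δ) x ≠ 0 := by
  simp [h]

theorem MCtx.eq_single_add {Γ : MCtx} {x : ℕ} {V : Multiset FTy} (h : V ≤ Γ x) :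
    ∃ Δ, Γ = MCtx.single x V + Δ := by
  refine exists_add_of_le fun y => ?_
  by_cases e : y = x
  · subst e; simpa
  · simp [e]

namespace QTyp

/-- Surplus declarations are passed down to the function side of an application and to the body of a
substitution; bound variables receive none of them. -/
theorem mono {M : Tm} {Γ : MCtx} {F : FTy} {n n' : ℕ} (h : QTyp M Γ F n) (Δ : MCtx)
    (hn : n ≤ n') : QTyp M (Γ + Δ) F n' := by
  induction M generalizing Γ Δ F n n' with
  | var x => exact ⟨Multiset.mem_add.2 (.inl h.1), h.2.trans_le hn⟩
  | lam M ih =>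
    obtain ⟨A, G, rfl, h⟩ := h
    have := ih h (scons 0 Δ) hn
    rw [← scons_add, add_zero] at this
    exact ⟨A, G, rfl, this⟩
  | app M N ih _ =>
    obtain ⟨A, Γ₁, Γ₂, n₁, n₂, rfl, hn', h₁, h₂⟩ := h
    exact ⟨A, Γ₁ + Δ, Γ₂, n₁, n₂, by abel, by omega, ih h₁ Δ le_rfl, h₂⟩
  | sub M N ih _ =>
    obtain ⟨A, Γ₁, Γ₂, n₁, n₂, hA, rfl, hn', h₁, h₂⟩ := h
    have := ih h₁ (scons 0 Δ) le_rfl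
    rw [← scons_add, add_zero] at this
    exact ⟨A, Γ₁ + Δ, Γ₂, n₁, n₂, hA, by abel, by omega, this, h₂⟩
  | weak x M ih => exact ⟨MCtx.ne_zero_add h.1 Δ, ih h.2 Δ hn⟩
  | contr x M ih =>
    obtain ⟨V₁, V₂, Γ', hV₁, hV₂, rfl, h⟩ := h
    have := ih h (scons 0 (scons 0 Δ)) hn
    rw [← scons_add, ← scons_add, add_zero, add_zero] at this
    exact ⟨V₁, V₂, Γ' + Δ, hV₁, hV₂, by abel, this⟩

theorem le {M : Tm} {Γ : MCtx} {F : FTy} {n n' : ℕ} (h : QTyp M Γ F n) (hn : n ≤ n') :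
    QTyp M Γ F n' := by
  simpa using h.mono 0 hn

theorem pos {M : Tm} {Γ : MCtx} {F : FTy} {n : ℕ} (h : QTyp M Γ F n) : 0 < n := by
  induction M generalizing Γ F n with
  | var x => exact h.2
  | lam M ih => obtain ⟨A, G, rfl, h⟩ := h; exact ih h
  | app M N ih _ =>
    obtain ⟨A, Γ₁, Γ₂, n₁, n₂, rfl, hn', h₁, h₂⟩ := h
    have := ih h₁; omega
  | sub M N ih _ =>
    obtain ⟨A, Γ₁, Γ₂, n₁, n₂, hA, rfl, hn', h₁, h₂⟩ := h
    have := ih h₁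
    have := Multiset.card_pos.2 hA
    omega
  | weak x M ih => exact ih h.2
  | contr x M ih => obtain ⟨V₁, V₂, Γ', hV₁, hV₂, rfl, h⟩ := h; exact ih h

theorem of_multi_singleton {M : Tm} {Γ : MCtx} {F : FTy} {n : ℕ} (h : Multi (QTyp M) Γ {F} n) :
    QTyp M Γ F n := by
  obtain ⟨Γ₁, Γ₂, n₁, n₂, rfl, rfl, h, -⟩ := h.erase (T := 0) rfl
  exact h.mono _ (by omega)

theorem of_multi_mem {M : Tm} {Γ : MCtx} {F : FTy} {S : Multiset FTy} {n : ℕ}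
    (h : Multi (QTyp M) Γ S n) (hF : F ∈ S) : QTyp M Γ F n := by
  obtain ⟨T, rfl⟩ := Multiset.exists_cons_of_mem hF
  obtain ⟨Γ₁, Γ₂, n₁, n₂, rfl, rfl, h, -⟩ := h.erase rfl
  exact h.mono _ (by omega)

end QTyp

/-! ### Renaming -/

@[simp] theorem up_zero (r : ℕ → ℕ) : up r 0 = 0 := rfl

@[simp] theorem up_succ (r : ℕ → ℕ) (n : ℕ) : up r (n + 1) = r n + 1 := rfl

theorem up_injective {r : ℕ → ℕ} (hr : r.Injective) : (up r).Injective := by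
  rintro (_ | x) (_ | y) h <;> simp_all
  exact hr h

/-- Action of a transformation of contexts under a binder. -/
def MCtx.lift (φ : MCtx →+ MCtx) : MCtx →+ MCtx where
  toFun Γ := scons (Γ 0) (φ fun x => Γ (x + 1))
  map_zero' := by
    rw [← scons_zero_zero]
    exact congrArg _ (map_zero φ)
  map_add' Γ Δ := by
    rw [← scons_add, ← map_add]; rfl

@[simp] theorem MCtx.lift_scons (φ : MCtx →+ MCtx) (A : Multiset FTy) (Γ : MCtx) :
    MCtx.lift φ (scons A Γ) = scons A (φ Γ) := rfl

theorem MCtx.lift_le {φ : MCtx →+ MCtx} {r : ℕ → ℕ} (hφ : ∀ Γ x, Γ x ≤ φ Γ (r x)) (Γ : MCtx)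
    (x : ℕ) : Γ x ≤ MCtx.lift φ Γ (up r x) := by
  cases x with
  | zero => exact le_rfl
  | succ x => exact hφ (fun x => Γ (x + 1)) x

/-- The context `Γ` transported along an injective renaming. -/
noncomputable def MCtx.extend (r : ℕ → ℕ) (hr : r.Injective) : MCtx →+ MCtx where
  toFun Γ := Function.extend r Γ 0
  map_zero' := by
    funext y
    by_cases h : ∃ x, r x = y
    · obtain ⟨x, rfl⟩ := h; simp [hr.extend_apply]
    · simp [Function.extend_apply' _ _ _ h]
  map_add' Γ Δ := by
    funext y
    by_cases h : ∃ x, r x = y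
    · obtain ⟨x, rfl⟩ := h; simp [hr.extend_apply]
    · simp [Function.extend_apply' _ _ _ h]

/-- The context `Γ` restricted along a renaming. -/
def MCtx.comap (r : ℕ → ℕ) : MCtx →+ MCtx where
  toFun Γ x := Γ (r x)
  map_zero' := rfl
  map_add' _ _ := rfl

theorem MCtx.exists_eq_extend_comap {r : ℕ → ℕ} (hr : r.Injective) (Γ : MCtx) :
    ∃ Δ, Γ = MCtx.extend r hr (MCtx.comap r Γ) + Δ := by
  refine exists_add_of_le fun y => ?_
  change Function.extend r (fun x => Γ (r x)) 0 y ≤ _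
  by_cases h : ∃ x, r x = y
  · obtain ⟨x, rfl⟩ := h; rw [hr.extend_apply]
  · simp [Function.extend_apply' _ _ _ h]

theorem MCtx.comap_up_scons (r : ℕ → ℕ) (A : Multiset FTy) (Γ : MCtx) :
    MCtx.comap (up r) (scons A Γ) = scons A (MCtx.comap r Γ) := by
  funext x; cases x <;> rfl

theorem MCtx.comap_single {r : ℕ → ℕ} (hr : r.Injective) (x : ℕ) (A : Multiset FTy) :
    MCtx.comap r (MCtx.single (r x) A) = MCtx.single x A := by
  funext y
  change MCtx.single (r x) A (r y) = _
  simp [Pi.single_apply, hr.eq_iff]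

/-- The freedom in `φ` covers both injective renamings (`MCtx.extend`) and the identification of two
variables (`MCtx.merge`). -/
theorem QTyp.rename {M : Tm} {r : ℕ → ℕ} {φ : MCtx →+ MCtx} (hφ : ∀ Γ x, Γ x ≤ φ Γ (r x))
    {Γ : MCtx} {F : FTy} {n : ℕ} (h : QTyp M Γ F n) : QTyp (M.rename r) (φ Γ) F n := by
  induction M generalizing r φ Γ F n with
  | var x => exact ⟨Multiset.mem_of_le (hφ _ _) h.1, h.2⟩
  | lam M ih =>
    obtain ⟨A, G, rfl, h⟩ := h
    exact ⟨A, G, rfl, ih (MCtx.lift_le hφ) h⟩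
  | app M N ih₁ ih₂ =>
    obtain ⟨A, Γ₁, Γ₂, n₁, n₂, rfl, hn', h₁, h₂⟩ := h
    exact ⟨A, _, _, n₁, n₂, map_add _ _ _, hn', ih₁ hφ h₁, h₂.map φ fun _ _ _ h => ih₂ hφ h⟩
  | sub M N ih₁ ih₂ =>
    obtain ⟨A, Γ₁, Γ₂, n₁, n₂, hA, rfl, hn', h₁, h₂⟩ := h
    exact ⟨A, _, _, n₁, n₂, hA, map_add _ _ _, hn', ih₁ (MCtx.lift_le hφ) h₁,
      h₂.map φ fun _ _ _ h => ih₂ hφ h⟩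
  | weak x M ih =>
    exact ⟨fun e => h.1 (by simpa [e] using hφ Γ x), ih hφ h.2⟩
  | contr x M ih =>
    obtain ⟨V₁, V₂, Γ', hV₁, hV₂, rfl, h⟩ := h
    obtain ⟨Δ, hΔ⟩ := MCtx.eq_single_add (Γ := φ (MCtx.single x (V₁ + V₂))) (x := r x)
      (V := V₁ + V₂) (by simpa using hφ (MCtx.single x (V₁ + V₂)) x)
    rw [map_add, hΔ, add_comm (MCtx.single _ _), ← add_assoc]
    have := (ih (MCtx.lift_le (MCtx.lift_le hφ)) h).mono (scons 0 (scons 0 Δ)) le_rfl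
    rw [MCtx.lift_scons, MCtx.lift_scons, ← scons_add, ← scons_add, add_zero, add_zero] at this
    exact ⟨V₁, V₂, φ Γ' + Δ, hV₁, hV₂, rfl, this⟩

/-- Injectivity serves the contraction case: the types declared for `r x` must come back as types of
`x` alone. -/
theorem QTyp.of_rename {M : Tm} {r : ℕ → ℕ} (hr : r.Injective) {Γ : MCtx} {F : FTy} {n : ℕ}
    (h : QTyp (M.rename r) Γ F n) : QTyp M (MCtx.comap r Γ) F n := by
  induction M generalizing r Γ F n with
  | var x => exact h
  | lam M ih =>
    obtain ⟨A, G, rfl, h⟩ := h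
    exact ⟨A, G, rfl, MCtx.comap_up_scons r _ _ ▸ ih (up_injective hr) h⟩
  | app M N ih₁ ih₂ =>
    obtain ⟨A, Γ₁, Γ₂, n₁, n₂, rfl, hn', h₁, h₂⟩ := h
    exact ⟨A, _, _, n₁, n₂, map_add _ _ _, hn', ih₁ hr h₁, h₂.map _ fun _ _ _ h => ih₂ hr h⟩
  | sub M N ih₁ ih₂ =>
    obtain ⟨A, Γ₁, Γ₂, n₁, n₂, hA, rfl, hn', h₁, h₂⟩ := h
    exact ⟨A, _, _, n₁, n₂, hA, map_add _ _ _, hn',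
      MCtx.comap_up_scons r _ _ ▸ ih₁ (up_injective hr) h₁, h₂.map _ fun _ _ _ h => ih₂ hr h⟩
  | weak x M ih => exact ⟨h.1, ih hr h.2⟩
  | contr x M ih =>
    obtain ⟨V₁, V₂, Γ', hV₁, hV₂, rfl, h⟩ := h
    refine ⟨V₁, V₂, MCtx.comap r Γ', hV₁, hV₂, ?_, ?_⟩
    · rw [map_add, MCtx.comap_single hr]
    · rw [← MCtx.comap_up_scons, ← MCtx.comap_up_scons]
      exact ih (up_injective (up_injective hr)) h

theorem QTyp.rename_iff {M : Tm} {r : ℕ → ℕ} (hr : r.Injective) {Γ : MCtx} {F : FTy} {n : ℕ} :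
    QTyp (M.rename r) Γ F n ↔ QTyp M (fun x => Γ (r x)) F n := by
  refine ⟨fun h => h.of_rename hr, fun h => ?_⟩
  -- The part of `Γ` outside the range of `r` is recovered by weakening.
  obtain ⟨Δ, hΔ⟩ := MCtx.exists_eq_extend_comap hr Γ
  rw [hΔ]
  exact (QTyp.rename (φ := MCtx.extend r hr) (fun Γ x => (hr.extend_apply Γ 0 x).ge) h).mono Δ le_rfl

theorem Multi.rename_iff {M : Tm} {r : ℕ → ℕ} (hr : r.Injective) {Γ : MCtx} {S : Multiset FTy}
    {n : ℕ} : Multi (QTyp (M.rename r)) Γ S n ↔ Multi (QTyp M) (fun x => Γ (r x)) S n := by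
  refine ⟨fun h => h.map (MCtx.comap r) fun _ _ _ h => h.of_rename hr, fun h => ?_⟩
  obtain ⟨Δ, hΔ⟩ := MCtx.exists_eq_extend_comap hr Γ
  rw [hΔ]
  exact (h.map (MCtx.extend r hr) fun _ _ _ h =>
    QTyp.rename (fun Γ x => (hr.extend_apply Γ 0 x).ge) h).mono Δ le_rfl

theorem add_right_injective_nat (k : ℕ) : Function.Injective fun n : ℕ => n + k :=
  fun _ _ h => Nat.add_right_cancel h

theorem QTyp.shift_iff {M : Tm} {A : Multiset FTy} {Γ : MCtx} {F : FTy} {n : ℕ} :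
    QTyp M.shift (scons A Γ) F n ↔ QTyp M Γ F n :=
  QTyp.rename_iff (add_right_injective_nat 1)

theorem Multi.shift_iff {M : Tm} {A : Multiset FTy} {Γ : MCtx} {S : Multiset FTy} {n : ℕ} :
    Multi (QTyp M.shift) (scons A Γ) S n ↔ Multi (QTyp M) Γ S n :=
  Multi.rename_iff (add_right_injective_nat 1)

theorem QTyp.shift2_iff {M : Tm} {A B : Multiset FTy} {Γ : MCtx} {F : FTy} {n : ℕ} :
    QTyp M.shift2 (scons A (scons B Γ)) F n ↔ QTyp M Γ F n :=
  QTyp.rename_iff (add_right_injective_nat 2)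

theorem Multi.shift2_iff {M : Tm} {A B : Multiset FTy} {Γ : MCtx} {S : Multiset FTy} {n : ℕ} :
    Multi (QTyp M.shift2) (scons A (scons B Γ)) S n ↔ Multi (QTyp M) Γ S n :=
  Multi.rename_iff (add_right_injective_nat 2)

theorem QTyp.up_shift_iff {M : Tm} {A B : Multiset FTy} {Γ : MCtx} {F : FTy} {n : ℕ} :
    QTyp (M.rename (up fun n => n + 1)) (scons A (scons B Γ)) F n ↔ QTyp M (scons A Γ) F n := by
  rw [QTyp.rename_iff (up_injective (add_right_injective_nat 1))]
  exact iff_of_eq (congrArg (QTyp M · F n) (by funext x; cases x <;> rfl))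

@[simp] theorem swap01_zero : swap01 0 = 1 := rfl

@[simp] theorem swap01_one : swap01 1 = 0 := rfl

@[simp] theorem swap01_add_two (n : ℕ) : swap01 (n + 2) = n + 2 :=
  Equiv.swap_apply_of_ne_of_ne (by omega) (by omega)

theorem swap01_swap01 (n : ℕ) : swap01 (swap01 n) = n := Equiv.swap_apply_self 0 1 n

theorem swap01_injective : swap01.Injective := (Equiv.swap 0 1).injective

theorem QTyp.swap01_iff {M : Tm} {A B : Multiset FTy} {Γ : MCtx} {F : FTy} {n : ℕ} :
    QTyp (M.rename swap01) (scons A (scons B Γ)) F n ↔ QTyp M (scons B (scons A Γ)) F n := by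
  rw [QTyp.rename_iff swap01_injective]
  exact iff_of_eq (congrArg (QTyp M · F n) (by funext x; rcases x with _ | _ | x <;> simp))

/-! ### Free variables are typed -/

theorem mem_unbind {s : Finset ℕ} {x : ℕ} : x ∈ unbind s ↔ x + 1 ∈ s := by
  simp only [unbind, Finset.mem_image, Finset.mem_erase]
  constructor
  · rintro ⟨_ | y, ⟨h0, hy⟩, rfl⟩
    · exact absurd rfl h0
    · exact hy
  · exact fun h => ⟨x + 1, ⟨by omega, h⟩, rfl⟩

theorem Multi.ne_zero_of {P : MCtx → FTy → ℕ → Prop} {x : ℕ} (hP : ∀ Γ F n, P Γ F n → Γ x ≠ 0)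
    {Γ : MCtx} {S : Multiset FTy} {n : ℕ} (h : Multi P Γ S n) (hS : S ≠ 0) : Γ x ≠ 0 := by
  cases h with
  | zero => exact absurd rfl hS
  | cons h _ => exact MCtx.ne_zero_add (hP _ _ _ h) _

/-- Typings are relevant for free variables because no subterm goes untyped: the multiset that types
an argument is never empty. -/
theorem QTyp.ne_zero {M : Tm} {Γ : MCtx} {F : FTy} {n x : ℕ} (h : QTyp M Γ F n) (hx : x ∈ M.fv) :
    Γ x ≠ 0 := by
  induction M generalizing Γ F n x with
  | var y =>
    obtain rfl : x = y := by simpa [fv] using hx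
    exact fun e => by simp [QTyp, e] at h
  | lam M ih =>
    obtain ⟨A, G, rfl, h⟩ := h
    have := ih h (mem_unbind.1 hx)
    exact this
  | app M N ih₁ ih₂ =>
    obtain ⟨A, Γ₁, Γ₂, n₁, n₂, rfl, hn', h₁, h₂⟩ := h
    rcases Finset.mem_union.1 hx with hx | hx
    · exact MCtx.ne_zero_add (ih₁ h₁ hx) _
    · rw [add_comm]
      exact MCtx.ne_zero_add (h₂.ne_zero_of (fun _ _ _ h => ih₂ h hx) A.toM_ne_zero) _
  | sub M N ih₁ ih₂ =>
    obtain ⟨A, Γ₁, Γ₂, n₁, n₂, hA, rfl, hn', h₁, h₂⟩ := h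
    rcases Finset.mem_union.1 hx with hx | hx
    · have := ih₁ h₁ (mem_unbind.1 hx)
      exact MCtx.ne_zero_add (x := x) this _
    · rw [add_comm]
      exact MCtx.ne_zero_add (h₂.ne_zero_of (fun _ _ _ h => ih₂ h hx) hA) _
  | weak y M ih =>
    rcases Finset.mem_insert.1 hx with rfl | hx
    · exact h.1
    · exact ih h.2 hx
  | contr y M ih =>
    obtain ⟨V₁, V₂, Γ', hV₁, hV₂, rfl, h⟩ := h
    have hx' : x = y ∨ x ∈ unbind (unbind M.fv) := by
      simp only [fv] at hx
      split_ifs at hx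
      · exact Finset.mem_insert.1 hx
      · exact .inr hx
    rcases hx' with rfl | hx
    · simp [hV₁]
    · have := ih h (mem_unbind.1 (mem_unbind.1 hx))
      exact MCtx.ne_zero_add (x := x) this _

theorem Multi.ne_zero {M : Tm} {Γ : MCtx} {S : Multiset FTy} {n x : ℕ}
    (h : Multi (QTyp M) Γ S n) (hS : S ≠ 0) (hx : x ∈ M.fv) : Γ x ≠ 0 :=
  h.ne_zero_of (fun _ _ _ h => h.ne_zero hx) hS

/-- The accounting behind propagation into an argument. Each of the `S.card` typings of `M` becomes
a typing of `M[x:=N]` with its own share of the typings of `N`, and each has a discount of one,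
whence the term `S.card` on the left. The share is never empty since `0 ∈ M.fv`. -/
theorem Multi.sub {M N : Tm} (h0 : 0 ∈ M.fv) {Θ : MCtx} {S : Multiset FTy} {m : ℕ}
    (h : Multi (QTyp M) Θ S m) (hS : S ≠ 0) : ∀ {Γ : MCtx} {n : ℕ}, Multi (QTyp N) Γ (Θ 0) n →
    ∃ k, k + S.card ≤ m + n + (Θ 0).card ∧
      Multi (QTyp (Tm.sub M N)) ((fun x => Θ (x + 1)) + Γ) S k := by
  induction h with
  | zero => exact absurd rfl hS
  | @cons Θ₁ Θ₂ F S m₁ m₂ h₁ h₂ ih =>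
    intro Γ n hN
    have hA := h₁.ne_zero h0
    -- The last copy takes everything that remains: the trailing `zero` may still declare types for
    -- the index `0`, and the typings of `N` for them have to go somewhere.
    by_cases hS' : S = 0
    · subst hS'
      have hA' : (Θ₁ + Θ₂) 0 ≠ 0 := MCtx.ne_zero_add hA _
      have := Multiset.card_pos.2 hA'
      refine ⟨m₁ + m₂ + n + ((Θ₁ + Θ₂) 0).card - 1, ?_, Multi.single ?_⟩
      · simp only [Multiset.cons_zero, Multiset.card_singleton]; omega
      · exact ⟨_, _, _, m₁, n, hA', rfl, by omega, by rw [scons_eta]; exact h₁.mono _ le_rfl, hN⟩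
    · obtain ⟨Γ₁, Γ₂, n₁, n₂, rfl, rfl, k₁, k₂⟩ := Multi.split (S := Θ₁ 0) (T := Θ₂ 0) hN
      obtain ⟨k, hk, h₃⟩ := ih hS' k₂
      have := Multiset.card_pos.2 hA
      have hc : ((Θ₁ + Θ₂) 0).card = (Θ₁ 0).card + (Θ₂ 0).card := Multiset.card_add _ _
      refine ⟨(m₁ + n₁ + (Θ₁ 0).card - 1) + k, ?_, ?_⟩
      · rw [Multiset.card_cons]; omega
      · have h₄ : QTyp (Tm.sub M N) ((fun x => Θ₁ (x + 1)) + Γ₁) F (m₁ + n₁ + (Θ₁ 0).card - 1) :=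
          ⟨_, _, _, m₁, n₁, hA, rfl, by omega, by rwa [scons_eta], k₁⟩
        have h₅ := Multi.cons h₄ h₃
        rwa [add_add_add_comm] at h₅

/-- The transformation of contexts performed by a contraction. -/
def MCtx.contr (x : ℕ) : MCtx →+ MCtx where
  toFun Γ := (fun y => Γ (y + 2)) + MCtx.single x (Γ 0 + Γ 1)
  map_zero' := by funext y; simp
  map_add' Γ Δ := by
    funext y
    simp only [MCtx.single, Pi.add_apply, Pi.single_apply]
    split_ifs <;> abel

@[simp] theorem MCtx.contr_scons (x : ℕ) (V₁ V₂ : Multiset FTy) (Γ : MCtx) :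
    MCtx.contr x (scons V₁ (scons V₂ Γ)) = Γ + MCtx.single x (V₁ + V₂) := rfl

/-- A contraction costs nothing, so it can be copied into each typing of the sum; the free variable
hypotheses provide the non-empty multisets that each copy requires. -/
theorem Multi.contr {x : ℕ} {M : Tm} (h0 : 0 ∈ M.fv) (h1 : 1 ∈ M.fv) {Γ : MCtx}
    {S : Multiset FTy} {n : ℕ} (h : Multi (QTyp M) Γ S n) :
    Multi (QTyp (Tm.contr x M)) (MCtx.contr x Γ) S n :=
  h.map _ fun Γ _ _ h => ⟨Γ 0, Γ 1, fun y => Γ (y + 2), h.ne_zero h0, h.ne_zero h1, rfl, by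
    have : scons (Γ 1) (fun y => Γ (y + 2)) = fun y => Γ (y + 1) := scons_eta fun y => Γ (y + 1)
    rwa [this, scons_eta]⟩

/-! ### Preservation of quantitative typing -/

/-- All quantitative typings of `M` are typings of `M'`. -/
def QLe (M M' : Tm) : Prop := ∀ Γ F n, QTyp M Γ F n → QTyp M' Γ F n

/-- All quantitative typings of `M` are typings of `M'`, with a smaller measure. -/
def QLt (M M' : Tm) : Prop := ∀ Γ F n, QTyp M Γ F n → ∃ k < n, QTyp M' Γ F k

theorem QLt.qle {M M' : Tm} (h : QLt M M') : QLe M M' := fun Γ F n hM =>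
  let ⟨_, hk, hM'⟩ := h Γ F n hM
  hM'.le hk.le

theorem QLe.trans {M N P : Tm} (h : QLe M N) (h' : QLe N P) : QLe M P :=
  fun Γ F n hM => h' Γ F n (h Γ F n hM)

namespace QLe

theorem lam {M M' : Tm} (h : QLe M M') : QLe (lam M) (lam M') := by
  rintro Γ F n ⟨A, G, rfl, hM⟩
  exact ⟨A, G, rfl, h _ _ _ hM⟩

theorem app {M M' N N' : Tm} (h : QLe M M') (h' : QLe N N') : QLe (app M N) (app M' N') := by
  rintro Γ F n ⟨A, Γ₁, Γ₂, n₁, n₂, rfl, hn, h₁, h₂⟩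
  exact ⟨A, Γ₁, Γ₂, n₁, n₂, rfl, hn, h _ _ _ h₁, h₂.imp h'⟩

theorem sub {M M' N N' : Tm} (h : QLe M M') (h' : QLe N N') : QLe (sub M N) (sub M' N') := by
  rintro Γ F n ⟨A, Γ₁, Γ₂, n₁, n₂, hA, rfl, hn, h₁, h₂⟩
  exact ⟨A, Γ₁, Γ₂, n₁, n₂, hA, rfl, hn, h _ _ _ h₁, h₂.imp h'⟩

theorem weak {x : ℕ} {M M' : Tm} (h : QLe M M') : QLe (weak x M) (weak x M') :=
  fun _ _ _ hM => ⟨hM.1, h _ _ _ hM.2⟩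

theorem contr {x : ℕ} {M M' : Tm} (h : QLe M M') : QLe (contr x M) (contr x M') := by
  rintro Γ F n ⟨V₁, V₂, Γ', hV₁, hV₂, rfl, hM⟩
  exact ⟨V₁, V₂, Γ', hV₁, hV₂, rfl, h _ _ _ hM⟩

theorem refl (M : Tm) : QLe M M := fun _ _ _ h => h

end QLe

namespace QLt

theorem lam {M M' : Tm} (h : QLt M M') : QLt (lam M) (lam M') := by
  rintro Γ F n ⟨A, G, rfl, hM⟩
  obtain ⟨k, hk, hM⟩ := h _ _ _ hM
  exact ⟨k, hk, A, G, rfl, hM⟩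

theorem appL {M M' N : Tm} (h : QLt M M') : QLt (app M N) (app M' N) := by
  rintro Γ F n ⟨A, Γ₁, Γ₂, n₁, n₂, rfl, hn, h₁, h₂⟩
  obtain ⟨k, hk, h₁⟩ := h _ _ _ h₁
  exact ⟨k + n₂ + A.toM.card, by omega, A, Γ₁, Γ₂, k, n₂, rfl, le_rfl, h₁, h₂⟩

theorem appR {M N N' : Tm} (h : QLt N N') : QLt (app M N) (app M N') := by
  rintro Γ F n ⟨A, Γ₁, Γ₂, n₁, n₂, rfl, hn, h₁, h₂⟩
  obtain ⟨k, hk, h₂⟩ := h₂.imp_lt h.qle h A.toM_ne_zero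
  exact ⟨n₁ + k + A.toM.card, by omega, A, Γ₁, Γ₂, n₁, k, rfl, le_rfl, h₁, h₂⟩

theorem subL {M M' N : Tm} (h : QLt M M') : QLt (sub M N) (sub M' N) := by
  rintro Γ F n ⟨A, Γ₁, Γ₂, n₁, n₂, hA, rfl, hn, h₁, h₂⟩
  obtain ⟨k, hk, h₁⟩ := h _ _ _ h₁
  have := Multiset.card_pos.2 hA
  exact ⟨k + n₂ + A.card - 1, by omega, A, Γ₁, Γ₂, k, n₂, hA, rfl, by omega, h₁, h₂⟩

theorem subR {M N N' : Tm} (h : QLt N N') : QLt (sub M N) (sub M N') := by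
  rintro Γ F n ⟨A, Γ₁, Γ₂, n₁, n₂, hA, rfl, hn, h₁, h₂⟩
  obtain ⟨k, hk, h₂⟩ := h₂.imp_lt h.qle h hA
  have := Multiset.card_pos.2 hA
  exact ⟨n₁ + k + A.card - 1, by omega, A, Γ₁, Γ₂, n₁, k, hA, rfl, by omega, h₁, h₂⟩

theorem weak {x : ℕ} {M M' : Tm} (h : QLt M M') : QLt (weak x M) (weak x M') := by
  rintro Γ F n ⟨hx, hM⟩
  obtain ⟨k, hk, hM⟩ := h _ _ _ hM
  exact ⟨k, hk, hx, hM⟩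

theorem contr {x : ℕ} {M M' : Tm} (h : QLt M M') : QLt (contr x M) (contr x M') := by
  rintro Γ F n ⟨V₁, V₂, Γ', hV₁, hV₂, rfl, hM⟩
  obtain ⟨k, hk, hM⟩ := h _ _ _ hM
  exact ⟨k, hk, V₁, V₂, Γ', hV₁, hV₂, rfl, hM⟩

end QLt

/-! ### Rules shared by `λS` and `λlxr` -/

/-- The cost of the argument types goes from `|A|` to `|A| - 1`. -/
theorem QLt.beta {M N : Tm} : QLt (Tm.app (Tm.lam M) N) (Tm.sub M N) := by
  rintro Γ F n ⟨A, Γ₁, Γ₂, n₁, n₂, rfl, hn, ⟨B, G, e, h₁⟩, h₂⟩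
  obtain ⟨rfl, rfl⟩ := FTy.arr.inj e
  have := Multiset.card_pos.2 A.toM_ne_zero
  exact ⟨n₁ + n₂ + A.toM.card - 1, by omega,
    _, Γ₁, Γ₂, n₁, n₂, A.toM_ne_zero, rfl, by omega, h₁, h₂⟩

theorem QLe.sub_var_zero {N : Tm} : QLe (Tm.sub (Tm.var 0) N) N := by
  rintro Γ F n ⟨A, Γ₁, Γ₂, n₁, n₂, hA, rfl, hn, ⟨h₁, -⟩, h₂⟩
  have := Multiset.card_pos.2 hA
  have := (QTyp.of_multi_mem h₂ h₁).mono Γ₁ (show n₂ ≤ n by omega)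
  rwa [add_comm] at this

/-- Types given to the variable in the typings of `M₂.shift` are not needed there; weakening moves
them to `M₁`, so that the substitution keeps its whole multiset and the cost is unchanged. -/
theorem QLe.sub_app_left {M₁ M₂ N : Tm} :
    QLe (Tm.sub (Tm.app M₁ M₂.shift) N) (Tm.app (Tm.sub M₁ N) M₂) := by
  rintro Γ F n ⟨A, Γ₁, Γ₂, n₁, n₂, hA, rfl, hn, ⟨B, Θ₁, Θ₂, m₁, m₂, e, hm, h₁, h₂⟩, h₃⟩
  obtain ⟨A₁, A₂, Δ₁, Δ₂, rfl, rfl, rfl, rfl⟩ := scons_eq_add e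
  have h₄ := h₁.mono (scons A₂ 0) le_rfl
  rw [← scons_add, add_zero] at h₄
  have := Multiset.card_pos.2 hA
  exact ⟨B, Δ₁ + Γ₂, Δ₂, m₁ + n₂ + (A₁ + A₂).card - 1, m₂, by abel, by omega,
    ⟨_, _, _, m₁, n₂, hA, rfl, by omega, h₄, h₃⟩, Multi.shift_iff.1 h₂⟩

/-- The substitution is copied into every typing of `M₂`. By `Multi.sub` these copies bring a
discount `|B| ≥ 1`, which makes up for the discount of the original. -/
theorem QLe.sub_app_right {M₁ M₂ N : Tm} (h0 : 0 ∈ M₂.fv) :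
    QLe (Tm.sub (Tm.app M₁.shift M₂) N) (Tm.app M₁ (Tm.sub M₂ N)) := by
  rintro Γ F n ⟨A, Γ₁, Γ₂, n₁, n₂, hA, rfl, hn, ⟨B, Θ₁, Θ₂, m₁, m₂, e, hm, h₁, h₂⟩, h₃⟩
  obtain ⟨A₁, A₂, Δ₁, Δ₂, rfl, rfl, rfl, rfl⟩ := scons_eq_add e
  have h₄ := h₂.mono (scons A₁ 0) le_rfl
  rw [← scons_add, add_zero] at h₄
  have hB := B.toM_ne_zero
  have hBc := Multiset.card_pos.2 hB
  obtain ⟨k, hk, h₅⟩ := h₄.sub h0 hB (N := N) (Γ := Γ₂) (n := n₂) (by rwa [scons_zero, add_comm])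
  rw [scons_zero, add_comm A₂] at hk
  exact ⟨B, Δ₁, Δ₂ + Γ₂, m₁, k, by abel, by omega, QTyp.shift_iff.1 h₁, h₅⟩

theorem QLe.sub_lam {M N : Tm} :
    QLe (Tm.sub (Tm.lam M) N) (Tm.lam (Tm.sub (M.rename swap01) N.shift)) := by
  rintro Γ F n ⟨A, Γ₁, Γ₂, n₁, n₂, hA, rfl, hn, ⟨B, G, rfl, h₁⟩, h₂⟩
  refine ⟨B, G, rfl, A, scons B.toM Γ₁, scons 0 Γ₂, n₁, n₂, hA, ?_, hn, QTyp.swap01_iff.2 h₁,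
    Multi.shift_iff.2 h₂⟩
  rw [← scons_add, add_zero]

theorem QLe.sub_comp {M₁ M₂ N : Tm} (h0 : 0 ∈ M₂.fv) :
    QLe (Tm.sub (Tm.sub (M₁.rename (up fun n => n + 1)) M₂) N) (Tm.sub M₁ (Tm.sub M₂ N)) := by
  rintro Γ F n ⟨A, Γ₁, Γ₂, n₁, n₂, hA, rfl, hn, ⟨B, Θ₁, Θ₂, m₁, m₂, hB, e, hm, h₁, h₂⟩, h₃⟩
  obtain ⟨A₁, A₂, Δ₁, Δ₂, rfl, rfl, rfl, rfl⟩ := scons_eq_add e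
  have h₄ := h₂.mono (scons A₁ 0) le_rfl
  rw [← scons_add, add_zero] at h₄
  have hBc := Multiset.card_pos.2 hB
  obtain ⟨k, hk, h₅⟩ := h₄.sub h0 hB (N := N) (Γ := Γ₂) (n := n₂) (by rwa [scons_zero, add_comm])
  rw [scons_zero, add_comm A₂] at hk
  exact ⟨B, Δ₁, Δ₂ + Γ₂, m₁, k, hB, by abel, by omega, QTyp.up_shift_iff.1 h₁, h₅⟩

theorem QLe.sub_sub_comm {M N₁ N₂ : Tm} : QLe (Tm.sub (Tm.sub M N₁.shift) N₂)
    (Tm.sub (Tm.sub (M.rename swap01) N₂.shift) N₁) := by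
  rintro Γ F n ⟨A, Γ₁, Γ₂, n₁, n₂, hA, rfl, hn, ⟨B, Θ₁, Θ₂, m₁, m₂, hB, e, hm, h₁, h₂⟩, h₃⟩
  obtain ⟨A₁, A₂, Δ₁, Δ₂, rfl, rfl, rfl, rfl⟩ := scons_eq_add e
  have h₄ := h₁.mono (scons 0 (scons A₂ 0)) le_rfl
  rw [← scons_add, ← scons_add, add_zero, add_zero] at h₄
  have := Multiset.card_pos.2 hA
  have := Multiset.card_pos.2 hB
  refine ⟨B, Δ₁ + Γ₂, Δ₂, m₁ + n₂ + (A₁ + A₂).card - 1, m₂, hB, by abel, by omega,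
    ⟨A₁ + A₂, scons B Δ₁, scons 0 Γ₂, m₁, n₂, hA, ?_, by omega, QTyp.swap01_iff.2 h₄,
      Multi.shift_iff.2 h₃⟩, Multi.shift_iff.1 h₂⟩
  rw [← scons_add, add_zero]

/-! ### Rules of `λS` -/

theorem QLe.sub_var_succ {y : ℕ} {N : Tm} : QLe (Tm.sub (Tm.var (y + 1)) N) (Tm.var y) := by
  rintro Γ F n ⟨A, Γ₁, Γ₂, n₁, n₂, hA, rfl, hn, ⟨h₁, h0⟩, h₂⟩
  have := Multiset.card_pos.2 hA
  exact ⟨Multiset.mem_add.2 (.inl h₁), by omega⟩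

/-- One discount becomes `1 + |B|`: one for the copy in `M₁`, and one for each typing of the
argument `M₂`. The cost drops by at least `|B| > 0`. -/
theorem QLt.sub_app {M₁ M₂ N : Tm} (h0 : 0 ∈ M₁.fv) (h0' : 0 ∈ M₂.fv) :
    QLt (sub (app M₁ M₂) N) (app (sub M₁ N) (sub M₂ N)) := by
  rintro Γ F n ⟨A, Γ₁, Γ₂, n₁, n₂, hA, rfl, hn, ⟨B, Θ₁, Θ₂, m₁, m₂, e, hm, h₁, h₂⟩, h₃⟩
  obtain ⟨A₁, A₂, Δ₁, Δ₂, rfl, rfl, rfl, rfl⟩ := scons_eq_add e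
  obtain ⟨Γ₃, Γ₄, n₃, n₄, rfl, rfl, h₃, h₄⟩ := h₃.split
  have hB := B.toM_ne_zero
  have hBc := Multiset.card_pos.2 hB
  obtain ⟨k, hk, h₅⟩ := h₂.sub h0' hB h₄
  have hA₁ : A₁ ≠ 0 := h₁.ne_zero h0
  have := Multiset.card_pos.2 hA₁
  rw [Multiset.card_add] at hn
  rw [scons_zero] at hk
  exact ⟨m₁ + n₃ + A₁.card - 1 + k + B.toM.card, by omega, B, Δ₁ + Γ₃, Δ₂ + Γ₄,
    m₁ + n₃ + A₁.card - 1, k, by abel, le_rfl, ⟨A₁, Δ₁, Γ₃, m₁, n₃, hA₁, rfl, by omega, h₁, h₃⟩, h₅⟩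

/-- Same count as for `QLt.sub_app`, with `M₂` the argument of a substitution. -/
theorem QLt.sub_sub {M₁ M₂ N : Tm} (h1 : 1 ∈ M₁.fv) (h0 : 0 ∈ M₂.fv) :
    QLt (sub (sub M₁ M₂) N) (sub (sub (M₁.rename swap01) N.shift) (sub M₂ N)) := by
  rintro Γ F n ⟨A, Γ₁, Γ₂, n₁, n₂, hA, rfl, hn, ⟨B, Θ₁, Θ₂, m₁, m₂, hB, e, hm, h₁, h₂⟩, h₃⟩
  obtain ⟨A₁, A₂, Δ₁, Δ₂, rfl, rfl, rfl, rfl⟩ := scons_eq_add e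
  obtain ⟨Γ₃, Γ₄, n₃, n₄, rfl, rfl, h₃, h₄⟩ := h₃.split
  have hBc := Multiset.card_pos.2 hB
  obtain ⟨k, hk, h₅⟩ := h₂.sub h0 hB h₄
  have hA₁ : A₁ ≠ 0 := h₁.ne_zero h1
  have := Multiset.card_pos.2 hA₁
  rw [Multiset.card_add] at hn
  rw [scons_zero] at hk
  refine ⟨m₁ + n₃ + A₁.card - 1 + k + B.card - 1, by omega, B, Δ₁ + Γ₃, Δ₂ + Γ₄,
    m₁ + n₃ + A₁.card - 1, k, hB, by abel, by omega,
    ⟨A₁, scons B Δ₁, scons 0 Γ₃, m₁, n₃, hA₁, ?_, by omega, QTyp.swap01_iff.2 h₁,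
      Multi.shift_iff.2 h₃⟩, h₅⟩
  rw [← scons_add, add_zero]

/-! ### Rules of `λlxr` -/

theorem QTyp.weakList {X : List ℕ} {M : Tm} {Γ : MCtx} {F : FTy} {n : ℕ} (h : QTyp M Γ F n)
    (hX : ∀ x ∈ X, Γ x ≠ 0) : QTyp (ESub.weakList X M) Γ F n := by
  induction X with
  | nil => exact h
  | cons x X ih =>
    exact ⟨hX x List.mem_cons_self, ih fun y hy => hX y (List.mem_cons_of_mem _ hy)⟩

/-- The typings of the erased `N` have positive cost, and they declare types for all of `N.fv`,
which is what the new weakenings require. -/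
theorem QLt.sub_weak_zero {M N : Tm} {X : List ℕ} (hX : X.toFinset = N.fv) :
    QLt (Tm.sub (Tm.weak 0 M.shift) N) (ESub.weakList X M) := by
  rintro Γ F n ⟨A, Γ₁, Γ₂, n₁, n₂, hA, rfl, hn, ⟨-, h₁⟩, h₂⟩
  obtain ⟨G, hG⟩ := Multiset.exists_mem_of_ne_zero hA
  have := (QTyp.of_multi_mem h₂ hG).pos
  have := Multiset.card_pos.2 hA
  refine ⟨n₁, by omega, ((QTyp.shift_iff.1 h₁).mono Γ₂ le_rfl).weakList fun x hx => ?_⟩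
  rw [add_comm]
  exact MCtx.ne_zero_add (h₂.ne_zero hA (by rw [← hX]; exact List.mem_toFinset.2 hx)) _

theorem QLe.sub_weak_succ {y : ℕ} {M N : Tm} :
    QLe (Tm.sub (Tm.weak (y + 1) M) N) (Tm.weak y (Tm.sub M N)) := by
  rintro Γ F n ⟨A, Γ₁, Γ₂, n₁, n₂, hA, rfl, hn, ⟨hy, h₁⟩, h₂⟩
  exact ⟨MCtx.ne_zero_add (x := y) hy _, A, Γ₁, Γ₂, n₁, n₂, hA, rfl, hn, h₁, h₂⟩

theorem QLe.lam_weak {y : ℕ} {M : Tm} :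
    QLe (Tm.lam (Tm.weak (y + 1) M)) (Tm.weak y (Tm.lam M)) := by
  rintro Γ F n ⟨A, G, rfl, hy, h⟩
  exact ⟨hy, A, G, rfl, h⟩

theorem QLe.app_weak_left {y : ℕ} {M N : Tm} :
    QLe (Tm.app (Tm.weak y M) N) (Tm.weak y (Tm.app M N)) := by
  rintro Γ F n ⟨A, Γ₁, Γ₂, n₁, n₂, rfl, hn, ⟨hy, h₁⟩, h₂⟩
  exact ⟨MCtx.ne_zero_add hy _, A, Γ₁, Γ₂, n₁, n₂, rfl, hn, h₁, h₂⟩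

theorem Multi.weak_inv {y : ℕ} {N : Tm} {Γ : MCtx} {S : Multiset FTy} {n : ℕ}
    (h : Multi (QTyp (Tm.weak y N)) Γ S n) (hS : S ≠ 0) : Γ y ≠ 0 ∧ Multi (QTyp N) Γ S n :=
  ⟨h.ne_zero_of (fun _ _ _ h => h.1) hS, h.imp fun _ _ _ h => h.2⟩

theorem QLe.app_weak_right {y : ℕ} {M N : Tm} :
    QLe (Tm.app M (Tm.weak y N)) (Tm.weak y (Tm.app M N)) := by
  rintro Γ F n ⟨A, Γ₁, Γ₂, n₁, n₂, rfl, hn, h₁, h₂⟩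
  obtain ⟨hy, h₂⟩ := h₂.weak_inv A.toM_ne_zero
  exact ⟨add_comm Γ₁ Γ₂ ▸ MCtx.ne_zero_add hy _, A, Γ₁, Γ₂, n₁, n₂, rfl, hn, h₁, h₂⟩

theorem QLe.sub_weak_right {y : ℕ} {M N : Tm} :
    QLe (Tm.sub M (Tm.weak y N)) (Tm.weak y (Tm.sub M N)) := by
  rintro Γ F n ⟨A, Γ₁, Γ₂, n₁, n₂, hA, rfl, hn, h₁, h₂⟩
  obtain ⟨hy, h₂⟩ := h₂.weak_inv hA
  exact ⟨add_comm Γ₁ Γ₂ ▸ MCtx.ne_zero_add hy _, A, Γ₁, Γ₂, n₁, n₂, hA, rfl, hn, h₁, h₂⟩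

/-- The transformation of contexts performed by the identification of the index `0` with `w`. -/
def MCtx.merge (w : ℕ) : MCtx →+ MCtx where
  toFun Γ := (fun y => Γ (y + 1)) + MCtx.single w (Γ 0)
  map_zero' := by funext y; simp
  map_add' Γ Δ := by
    funext y
    simp only [MCtx.single, Pi.add_apply, Pi.single_apply]
    split_ifs <;> abel

/-- `V₂` follows the renamed variable to `w`, and `V₁`, which belonged to the weakened variable, is
added by weakening. -/
theorem QLe.contr_weak_zero {w : ℕ} {M : Tm} :
    QLe (Tm.contr w (Tm.weak 0 M.shift)) (M.rename (scons w id)) := by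
  rintro Γ F n ⟨V₁, V₂, Γ', hV₁, hV₂, rfl, -, h⟩
  have hle : ∀ Γ x, Γ x ≤ MCtx.merge w Γ (scons w id x) := by
    rintro Γ (_ | x)
    · change _ ≤ Γ (w + 1) + MCtx.single w (Γ 0) w
      simp
    · change _ ≤ Γ (x + 1) + _
      simp
  have := ((QTyp.shift_iff.1 h).rename hle).mono (MCtx.single w V₁) le_rfl
  change QTyp _ (Γ' + MCtx.single w V₂ + MCtx.single w V₁) F n at this
  rwa [add_assoc, ← Pi.single_add, add_comm V₂] at this

theorem QLe.contr_weak {w x : ℕ} {M : Tm} :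
    QLe (Tm.contr w (Tm.weak (x + 2) M)) (Tm.weak x (Tm.contr w M)) := by
  rintro Γ F n ⟨V₁, V₂, Γ', hV₁, hV₂, rfl, hx, h⟩
  exact ⟨MCtx.ne_zero_add (x := x) hx _, V₁, V₂, Γ', hV₁, hV₂, rfl, h⟩

theorem rotOut_add_three (n : ℕ) : rotOut (n + 3) = n + 3 := by simp [rotOut]

theorem rotIn_add_three (n : ℕ) : rotIn (n + 3) = n + 3 := by simp [rotIn]

theorem rotIn_rotOut (n : ℕ) : rotIn (rotOut n) = n := by
  rcases n with _ | _ | _ | n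
  iterate 3 rfl
  rw [rotOut_add_three, rotIn_add_three]

theorem rotOut_rotIn (n : ℕ) : rotOut (rotIn n) = n := by
  rcases n with _ | _ | _ | n
  iterate 3 rfl
  rw [rotIn_add_three, rotOut_add_three]

theorem QTyp.rotOut_iff {M : Tm} {A B C : Multiset FTy} {Γ : MCtx} {F : FTy} {n : ℕ} :
    QTyp (M.rename rotOut) (scons A (scons B (scons C Γ))) F n ↔
      QTyp M (scons C (scons A (scons B Γ))) F n := by
  rw [QTyp.rename_iff (Function.LeftInverse.injective rotIn_rotOut)]
  refine iff_of_eq (congrArg (QTyp M · F n) ?_)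
  funext x
  rcases x with _ | _ | _ | x
  iterate 3 rfl
  rw [rotOut_add_three]; rfl

theorem QTyp.rotIn_iff {M : Tm} {A B C : Multiset FTy} {Γ : MCtx} {F : FTy} {n : ℕ} :
    QTyp (M.rename rotIn) (scons C (scons A (scons B Γ))) F n ↔
      QTyp M (scons A (scons B (scons C Γ))) F n := by
  rw [QTyp.rename_iff (Function.LeftInverse.injective rotOut_rotIn)]
  refine iff_of_eq (congrArg (QTyp M · F n) ?_)
  funext x
  rcases x with _ | _ | _ | x
  iterate 3 rfl
  rw [rotIn_add_three]; rfl

theorem QLe.contr_lam {w : ℕ} {M : Tm} :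
    QLe (Tm.contr w (Tm.lam M)) (Tm.lam (Tm.contr (w + 1) (M.rename rotOut))) := by
  rintro Γ F n ⟨V₁, V₂, Γ', hV₁, hV₂, rfl, A, G, rfl, h⟩
  refine ⟨A, G, rfl, V₁, V₂, scons A.toM Γ', hV₁, hV₂, ?_, QTyp.rotOut_iff.2 h⟩
  rw [MCtx.single_succ_eq_scons, ← scons_add, add_zero]

theorem QLe.contr_app_left {w : ℕ} {M N : Tm} :
    QLe (Tm.contr w (Tm.app M N.shift2)) (Tm.app (Tm.contr w M) N) := by
  rintro Γ F n ⟨V₁, V₂, Γ', hV₁, hV₂, rfl, B, Θ₁, Θ₂, m₁, m₂, e, hm, h₁, h₂⟩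
  obtain ⟨A₁, A₂, Δ₁, Δ₂, rfl, rfl, rfl, e₂⟩ := scons_eq_add e
  obtain ⟨B₁, B₂, Δ₁, Δ₂, rfl, rfl, rfl, rfl⟩ := scons_eq_add e₂
  have h₃ := h₁.mono (scons A₂ (scons B₂ 0)) le_rfl
  rw [← scons_add, ← scons_add, add_zero] at h₃
  exact ⟨B, _, Δ₂, m₁, m₂, add_right_comm _ _ _, hm,
    ⟨_, _, Δ₁, hV₁, hV₂, rfl, h₃⟩, Multi.shift2_iff.1 h₂⟩

theorem QLe.contr_app_right {w : ℕ} {M N : Tm} (h0 : 0 ∈ N.fv) (h1 : 1 ∈ N.fv) :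
    QLe (Tm.contr w (Tm.app M.shift2 N)) (Tm.app M (Tm.contr w N)) := by
  rintro Γ F n ⟨V₁, V₂, Γ', hV₁, hV₂, rfl, B, Θ₁, Θ₂, m₁, m₂, e, hm, h₁, h₂⟩
  obtain ⟨A₁, A₂, Δ₁, Δ₂, rfl, rfl, rfl, e₂⟩ := scons_eq_add e
  obtain ⟨B₁, B₂, Δ₁, Δ₂, rfl, rfl, rfl, rfl⟩ := scons_eq_add e₂
  have h₃ := (h₂.mono (scons A₁ (scons B₁ 0)) le_rfl).contr (x := w) h0 h1
  rw [← scons_add, ← scons_add, add_zero, MCtx.contr_scons, add_comm A₂, add_comm B₂] at h₃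
  exact ⟨B, Δ₁, _, m₁, m₂, add_assoc _ _ _, hm, QTyp.shift2_iff.1 h₁, h₃⟩

theorem QTyp.up_shift2_iff {M : Tm} {A B C : Multiset FTy} {Γ : MCtx} {F : FTy} {n : ℕ} :
    QTyp (M.rename (up fun n => n + 2)) (scons A (scons B (scons C Γ))) F n ↔
      QTyp M (scons A Γ) F n := by
  rw [QTyp.rename_iff (up_injective (add_right_injective_nat 2))]
  exact iff_of_eq (congrArg (QTyp M · F n) (by funext x; cases x <;> rfl))

theorem QLe.contr_sub {w : ℕ} {M N : Tm} (h0 : 0 ∈ N.fv) (h1 : 1 ∈ N.fv) :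
    QLe (Tm.contr w (Tm.sub (M.rename (up fun n => n + 2)) N)) (Tm.sub M (Tm.contr w N)) := by
  rintro Γ F n ⟨V₁, V₂, Γ', hV₁, hV₂, rfl, B, Θ₁, Θ₂, m₁, m₂, hB, e, hm, h₁, h₂⟩
  obtain ⟨A₁, A₂, Δ₁, Δ₂, rfl, rfl, rfl, e₂⟩ := scons_eq_add e
  obtain ⟨B₁, B₂, Δ₁, Δ₂, rfl, rfl, rfl, rfl⟩ := scons_eq_add e₂
  have h₃ := (h₂.mono (scons A₁ (scons B₁ 0)) le_rfl).contr (x := w) h0 h1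
  rw [← scons_add, ← scons_add, add_zero, MCtx.contr_scons, add_comm A₂, add_comm B₂] at h₃
  exact ⟨B, Δ₁, _, m₁, m₂, hB, add_assoc _ _ _, hm, QTyp.up_shift2_iff.1 h₁, h₃⟩

/-! ### Equivalences of `λlxr` -/

theorem QLe.contr_assoc {w : ℕ} {M : Tm} : QLe (Tm.contr w (Tm.contr 0 M))
    (Tm.contr w (Tm.contr 0 (M.rename fun n => Equiv.swap 1 3 n))) := by
  rintro Γ F n ⟨V₁, V₂, Γ', hV₁, hV₂, rfl, W₁, W₂, Δ, hW₁, hW₂, e, h⟩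
  rw [MCtx.single_zero_eq_scons] at e
  obtain ⟨A, A₂, Δ', Δ₂, rfl, e₁, rfl, e⟩ := scons_eq_add e
  obtain ⟨rfl, rfl⟩ := scons_inj e₁
  rw [add_zero] at e
  subst e
  -- `A` is the surplus that the intermediate variable has besides its two copies; it stays in place
  -- while `W₂` and `V₂` are exchanged.
  refine ⟨A + (W₁ + V₂), W₂, Γ', by simp [hW₁], hW₂, ?_, W₁, V₂, scons A (scons W₂ Γ'), hW₁, hV₂,
    ?_, ?_⟩
  · rw [add_assoc A, add_assoc A, add_right_comm W₁]
  · rw [MCtx.single_zero_eq_scons, ← scons_add, add_zero]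
  · rw [QTyp.rename_iff (Equiv.swap 1 3).injective]
    refine (iff_of_eq (congrArg (QTyp M · F n) ?_)).1 h
    funext x
    rcases x with _ | _ | _ | _ | x
    iterate 4 rfl
    rw [Equiv.swap_apply_of_ne_of_ne (by omega) (by omega)]; rfl

theorem QLe.contr_comm {x : ℕ} {M : Tm} : QLe (Tm.contr x M) (Tm.contr x (M.rename swap01)) := by
  rintro Γ F n ⟨V₁, V₂, Γ', hV₁, hV₂, rfl, h⟩
  exact ⟨V₂, V₁, Γ', hV₂, hV₁, by rw [add_comm V₁], QTyp.swap01_iff.2 h⟩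

theorem swapPairs_add_four (n : ℕ) : swapPairs (n + 4) = n + 4 := by simp [swapPairs]

theorem swapPairs_swapPairs (n : ℕ) : swapPairs (swapPairs n) = n := by
  rcases n with _ | _ | _ | _ | n
  iterate 4 rfl
  rw [swapPairs_add_four, swapPairs_add_four]

theorem QLe.contr_contr_comm {x x' : ℕ} {M : Tm} : QLe (Tm.contr x' (Tm.contr (x + 2) M))
    (Tm.contr x (Tm.contr (x' + 2) (M.rename swapPairs))) := by
  rintro Γ F n ⟨V₁, V₂, Γ', hV₁, hV₂, rfl, W₁, W₂, Δ, hW₁, hW₂, e, h⟩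
  rw [MCtx.single_succ_eq_scons, MCtx.single_succ_eq_scons] at e
  obtain ⟨A, A₂, Δ₁, Δ₂, rfl, e₁, rfl, e⟩ := scons_eq_add e
  obtain ⟨rfl, rfl⟩ := scons_inj e₁
  obtain ⟨B, B₂, Δ₁, Δ₂, rfl, e₁, rfl, rfl⟩ := scons_eq_add e
  obtain ⟨rfl, rfl⟩ := scons_inj e₁
  rw [add_zero] at hV₁ hV₂
  refine ⟨W₁, W₂, Δ₁ + MCtx.single x' (A + B), hW₁, hW₂, ?_, A, B, scons W₁ (scons W₂ Δ₁), hV₁, hV₂,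
    ?_, ?_⟩
  · rw [add_zero, add_zero, add_right_comm]
  · rw [MCtx.single_succ_eq_scons, MCtx.single_succ_eq_scons, ← scons_add, ← scons_add, add_zero,
      add_zero]
  · rw [QTyp.rename_iff (Function.LeftInverse.injective swapPairs_swapPairs)]
    refine (iff_of_eq (congrArg (QTyp M · F n) ?_)).1 h
    funext x
    rcases x with _ | _ | _ | _ | x
    iterate 4 rfl
    rw [swapPairs_add_four]; rfl

theorem QLe.weak_comm {x y : ℕ} {M : Tm} :
    QLe (Tm.weak x (Tm.weak y M)) (Tm.weak y (Tm.weak x M)) :=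
  fun _ _ _ ⟨hx, hy, h⟩ => ⟨hy, hx, h⟩

theorem QLe.sub_contr {w : ℕ} {M N : Tm} : QLe (Tm.sub (Tm.contr (w + 1) M) N)
    (Tm.contr w (Tm.sub (M.rename rotIn) N.shift2)) := by
  rintro Γ F n ⟨A, Γ₁, Γ₂, n₁, n₂, hA, rfl, hn, ⟨V₁, V₂, Δ, hV₁, hV₂, e, h₁⟩, h₂⟩
  rw [MCtx.single_succ_eq_scons] at e
  obtain ⟨A, A₂, Δ₁, Δ₂, rfl, e₁, rfl, rfl⟩ := scons_eq_add e
  obtain ⟨rfl, rfl⟩ := scons_inj e₁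
  rw [add_zero] at *
  refine ⟨V₁, V₂, Δ₁ + Γ₂, hV₁, hV₂, add_right_comm _ _ _, A, scons V₁ (scons V₂ Δ₁),
    scons 0 (scons 0 Γ₂), n₁, n₂, hA, ?_, hn, QTyp.rotIn_iff.2 h₁, Multi.shift2_iff.2 h₂⟩
  rw [← scons_add, ← scons_add, add_zero, add_zero]

theorem QLe.contr_sub_shift2 {w : ℕ} {M N : Tm} :
    QLe (Tm.contr w (Tm.sub (M.rename rotIn) N.shift2)) (Tm.sub (Tm.contr (w + 1) M) N) := by
  rintro Γ F n ⟨V₁, V₂, Γ', hV₁, hV₂, rfl, B, Θ₁, Θ₂, m₁, m₂, hB, e, hm, h₁, h₂⟩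
  obtain ⟨A₁, A₂, Δ₁, Δ₂, rfl, rfl, rfl, e₂⟩ := scons_eq_add e
  obtain ⟨B₁, B₂, Δ₁, Δ₂, rfl, rfl, rfl, rfl⟩ := scons_eq_add e₂
  have h₃ := h₁.mono (scons 0 (scons A₂ (scons B₂ 0))) le_rfl
  rw [← scons_add, ← scons_add, ← scons_add, add_zero, add_zero] at h₃
  refine ⟨B, Δ₁ + MCtx.single w (A₁ + A₂ + (B₁ + B₂)), Δ₂, m₁, m₂, hB, add_right_comm _ _ _, hm,
    ⟨_, _, scons B Δ₁, hV₁, hV₂, ?_, QTyp.rotIn_iff.1 h₃⟩, Multi.shift2_iff.1 h₂⟩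
  rw [MCtx.single_succ_eq_scons, ← scons_add, add_zero]

/-! ### Duplication of explicit substitutions -/

/-- The context inside `C_X^{Y,Z}( )` that has the types of `X` in `Δ₁` for `Y`, those in `Δ₂` for
`Z`, and `Γ` for the outer variables. -/
def MCtx.pairs (Δ₁ Δ₂ Γ : MCtx) : List ℕ → MCtx
  | [] => Γ
  | x :: X => scons (Δ₁ x) (scons (Δ₂ x) (MCtx.pairs Δ₁ Δ₂ Γ X))

namespace MCtx

theorem pairs_add (Δ₁ Δ₂ Γ Δ₁' Δ₂' Γ' : MCtx) (X : List ℕ) :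
    pairs (Δ₁ + Δ₁') (Δ₂ + Δ₂') (Γ + Γ') X = pairs Δ₁ Δ₂ Γ X + pairs Δ₁' Δ₂' Γ' X := by
  induction X with
  | nil => rfl
  | cons x X ih => simp only [pairs, Pi.add_apply, scons_add, ih]

theorem pairs_add_single (Δ₁ Δ₂ Γ : MCtx) (x : ℕ) (V : Multiset FTy) (X : List ℕ) :
    pairs Δ₁ Δ₂ (Γ + single x V) X = pairs Δ₁ Δ₂ Γ X + single (x + 2 * X.length) V := by
  induction X with
  | nil => rfl
  | cons y X ih =>
    rw [List.length_cons, show x + 2 * (X.length + 1) = x + 2 * X.length + 1 + 1 by ring,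
      single_succ_eq_scons, single_succ_eq_scons, pairs, pairs, ih, ← scons_add, ← scons_add,
      add_zero, add_zero]

theorem pairs_outer (Δ₁ Δ₂ Γ : MCtx) (v : ℕ) (X : List ℕ) :
    pairs Δ₁ Δ₂ Γ X (v + 2 * X.length) = Γ v := by
  induction X with
  | nil => rfl
  | cons y X ih => exact ih

theorem pairs_even (Δ₁ Δ₂ Γ : MCtx) {X : List ℕ} {i : ℕ} (h : i < X.length) :
    pairs Δ₁ Δ₂ Γ X (2 * i) = Δ₁ X[i] := by
  induction X generalizing i with
  | nil => simp at h
  | cons y X ih =>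
    cases i with
    | zero => rfl
    | succ i => exact ih (by simpa using h)

theorem pairs_odd (Δ₁ Δ₂ Γ : MCtx) {X : List ℕ} {i : ℕ} (h : i < X.length) :
    pairs Δ₁ Δ₂ Γ X (2 * i + 1) = Δ₂ X[i] := by
  induction X generalizing i with
  | nil => simp at h
  | cons y X ih =>
    cases i with
    | zero => rfl
    | succ i => exact ih (by simpa using h)

/-- The context `Γ` without the variables of `X`. -/
def off (X : List ℕ) (Γ : MCtx) : MCtx := fun v => if v ∈ X then 0 else Γ v

theorem off_add_sum {X : List ℕ} (hX : X.Nodup) (Γ : MCtx) :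
    off X Γ + (X.map fun x => single x (Γ x)).sum = Γ := by
  induction X with
  | nil => funext v; simp [off]
  | cons x X ih =>
    obtain ⟨hx, hX⟩ := List.nodup_cons.1 hX
    have : off X Γ = off (x :: X) Γ + single x (Γ x) := by
      funext v
      by_cases hv : v = x
      · subst hv; simp [off, hx]
      · simp [off, hv]
    rw [List.map_cons, List.sum_cons, ← add_assoc, ← this, ih hX]

/-- Types of variables outside `X` are stored in the outer part, hence `off X Δ₁`; restriction along
`toY X` then reassembles `Δ₁`. -/
theorem pairs_toY (Δ₁ Δ₂ : MCtx) (X : List ℕ) :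
    (fun v => pairs Δ₁ Δ₂ (off X Δ₁) X (toY X v)) = Δ₁ := by
  funext v
  by_cases hv : v ∈ X
  · have := List.idxOf_lt_length_iff.2 hv
    simp only [toY, hv, if_true]
    rw [pairs_even _ _ _ this, List.getElem_idxOf this]
  · simp only [toY, hv, if_false, pairs_outer, off]

theorem pairs_toZ (Δ₁ Δ₂ : MCtx) (X : List ℕ) :
    (fun v => pairs Δ₁ Δ₂ (off X Δ₂) X (toZ X v)) = Δ₂ := by
  funext v
  by_cases hv : v ∈ X
  · have := List.idxOf_lt_length_iff.2 hv
    simp only [toZ, hv, if_true]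
    rw [pairs_odd _ _ _ this, List.getElem_idxOf this]
  · simp only [toZ, hv, if_false, pairs_outer, off]

end MCtx

theorem toY_injective (X : List ℕ) : (toY X).Injective := by
  intro v w h
  unfold toY at h
  split_ifs at h with hv hw hw
  · exact (List.idxOf_inj hv).1 (by omega)
  · have := List.idxOf_lt_length_iff.2 hv; omega
  · have := List.idxOf_lt_length_iff.2 hw; omega
  · omega

theorem toZ_injective (X : List ℕ) : (toZ X).Injective := by
  intro v w h
  unfold toZ at h
  split_ifs at h with hv hw hw
  · exact (List.idxOf_inj hv).1 (by omega)
  · have := List.idxOf_lt_length_iff.2 hv; omega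
  · have := List.idxOf_lt_length_iff.2 hw; omega
  · omega

/-- The head of the list is the innermost contraction. The induction absorbs it into the term and
adds the sum of its two multisets to `Γ`, so both are generalised. -/
theorem QTyp.contrList {X : List ℕ} {M : Tm} {Δ₁ Δ₂ Γ : MCtx} {F : FTy} {n : ℕ}
    (h : QTyp M (MCtx.pairs Δ₁ Δ₂ Γ X) F n) (h₁ : ∀ x ∈ X, Δ₁ x ≠ 0) (h₂ : ∀ x ∈ X, Δ₂ x ≠ 0) :
    QTyp (ESub.contrList X M) (Γ + (X.map fun x => MCtx.single x ((Δ₁ + Δ₂) x)).sum) F n := by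
  induction X generalizing M Γ with
  | nil => rw [List.map_nil, List.sum_nil, add_zero]; exact h
  | cons x X ih =>
    rw [List.map_cons, List.sum_cons, ← add_assoc]
    refine ih ?_ (fun y hy => h₁ y (List.mem_cons_of_mem _ hy))
      (fun y hy => h₂ y (List.mem_cons_of_mem _ hy))
    exact ⟨Δ₁ x, Δ₂ x, MCtx.pairs Δ₁ Δ₂ Γ X, h₁ x List.mem_cons_self, h₂ x List.mem_cons_self,
      MCtx.pairs_add_single _ _ _ _ _ _, h⟩

theorem QTyp.up_up_iff {M : Tm} {r : ℕ → ℕ} (hr : r.Injective) {A B : Multiset FTy} {Γ : MCtx}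
    {F : FTy} {n : ℕ} : QTyp (M.rename (up (up r))) (scons A (scons B Γ)) F n ↔
      QTyp M (scons A (scons B fun x => Γ (r x))) F n := by
  rw [QTyp.rename_iff (up_injective (up_injective hr))]
  exact iff_of_eq (congrArg (QTyp M · F n) (by funext x; rcases x with _ | _ | x <;> rfl))

/-- The typings of `N` are shared between the two renamed copies. Two substitutions with discount
one replace a single one, and contractions are free, so the cost drops. -/
theorem QLt.sub_contr_zero {M N : Tm} {X : List ℕ} (hX : X.Nodup) (hN : X.toFinset = N.fv) :
    QLt (Tm.sub (Tm.contr 0 (M.rename (up (up fun n => n + 1)))) N)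
      (ESub.contrList X
        (Tm.sub (Tm.sub (M.rename (up (up fun n => n + 2 * X.length))) (N.rename (toY X)).shift)
          (N.rename (toZ X)))) := by
  rintro Γ F n ⟨A, Γ₁, Γ₂, n₁, n₂, hA, rfl, hn, ⟨V₁, V₂, Γ', hV₁, hV₂, e, h₁⟩, h₂⟩
  rw [MCtx.single_zero_eq_scons] at e
  obtain ⟨A', A₂, Γ', Δ₂, rfl, e₁, rfl, rfl⟩ := scons_eq_add e
  obtain ⟨rfl, rfl⟩ := scons_inj e₁
  rw [add_zero]
  rw [QTyp.up_up_iff (add_right_injective_nat 1)] at h₁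
  simp only [scons_succ] at h₁
  -- `Γ₅` types the surplus `A'` that neither contracted variable uses; `Γ₃` and `Γ₄` are for `V₁`
  -- and `V₂`.
  obtain ⟨Γ₅, Γ₂, n₅, n₂, rfl, rfl, h₅, h₂⟩ := h₂.split
  obtain ⟨Γ₃, Γ₄, n₃, n₄, rfl, rfl, h₃, h₄⟩ := h₂.split
  have hX' : ∀ x ∈ X, x ∈ N.fv := fun x hx => hN ▸ List.mem_toFinset.2 hx
  have hc₁ := Multiset.card_pos.2 hV₁
  have hc₂ := Multiset.card_pos.2 hV₂
  rw [Multiset.card_add, Multiset.card_add] at hn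
  have key : QTyp (Tm.sub (Tm.sub (M.rename (up (up fun n => n + 2 * X.length)))
      (N.rename (toY X)).shift) (N.rename (toZ X)))
      (MCtx.pairs Γ₃ Γ₄ (Γ' + MCtx.off X Γ₃ + MCtx.off X Γ₄) X) F
      (n₁ + n₃ + V₁.card - 1 + n₄ + V₂.card - 1) := by
    -- The context splits into three: `Γ'` for `M`, `Γ₃` in the `Y` slots for the first copy of `N`,
    -- `Γ₄` in the `Z` slots for the second.
    refine ⟨V₂, MCtx.pairs 0 0 Γ' X + MCtx.pairs Γ₃ 0 (MCtx.off X Γ₃) X,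
      MCtx.pairs 0 Γ₄ (MCtx.off X Γ₄) X, n₁ + n₃ + V₁.card - 1, n₄, hV₂, ?_, by omega,
      ⟨V₁, scons V₂ (MCtx.pairs 0 0 Γ' X), scons 0 (MCtx.pairs Γ₃ 0 (MCtx.off X Γ₃) X), n₁, n₃,
        hV₁, ?_, by omega, ?_, ?_⟩, ?_⟩
    · rw [← MCtx.pairs_add, ← MCtx.pairs_add]; simp only [zero_add, add_zero]
    · rw [← scons_add, add_zero]
    · rw [QTyp.up_up_iff (add_right_injective_nat _)]
      simpa only [MCtx.pairs_outer] using h₁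
    · rw [Multi.shift_iff, Multi.rename_iff (toY_injective X), MCtx.pairs_toY]; exact h₃
    · rw [Multi.rename_iff (toZ_injective X), MCtx.pairs_toZ]; exact h₄
  have h := (key.contrList (fun x hx => h₃.ne_zero hV₁ (hX' x hx))
    (fun x hx => h₄.ne_zero hV₂ (hX' x hx))).mono Γ₅ le_rfl
  have hoff : MCtx.off X Γ₃ + MCtx.off X Γ₄ = MCtx.off X (Γ₃ + Γ₄) := by
    funext v; simp only [MCtx.off, Pi.add_apply]; split_ifs <;> simp
  -- The contractions give back the types of `X` in `Γ₃ + Γ₄`, which complete the part outside `X`.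
  rw [add_assoc Γ', hoff, add_assoc Γ', MCtx.off_add_sum hX, add_assoc, add_comm _ Γ₅] at h
  exact ⟨_, by omega, h⟩

/-! ### A polynomial interpretation of the propagation rules -/

/-- A polynomial interpretation of terms that decreases with the rules that duplicate nothing. -/
def Tm.rk : Tm → ℕ
  | .var _ => 2
  | .lam M => 2 * M.rk + 1
  | .app M N => 2 * (M.rk + N.rk) + 1
  | .sub M N => M.rk * (N.rk + 1)
  | .weak _ M => M.rk + 1
  | .contr _ M => 2 * M.rk

/-- The bound `2`, rather than `1`, makes `M[x:=W_y(N)] → W_y(M[x:=N])` strict: the left side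
exceeds `M.rk * (N.rk + 1)` by `M.rk`, the right side by `1`. -/
theorem Tm.two_le_rk (M : Tm) : 2 ≤ M.rk := by
  induction M with
  | sub M N ih₁ ih₂ => simp only [rk]; nlinarith
  | _ => simp only [rk]; omega

@[simp] theorem Tm.rk_rename (M : Tm) (r : ℕ → ℕ) : (M.rename r).rk = M.rk := by
  induction M generalizing r with
  | _ => simp_all [rk, Tm.rename]

@[simp] theorem Tm.rk_shift (M : Tm) : M.shift.rk = M.rk := M.rk_rename _

@[simp] theorem Tm.rk_shift2 (M : Tm) : M.shift2.rk = M.rk := M.rk_rename _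

/-- `M'` is smaller than `M`, for the lexicographic order of the measure of typings and `rk`. -/
def Decr (M M' : Tm) : Prop := QLt M M' ∨ QLe M M' ∧ M'.rk < M.rk

/-- A strict decrease of cost survives in every context because each argument is typed at least
once; `rk` is strictly monotone in each position. -/
theorem Decr.of_cong {R : Tm → Tm → Prop} (hR : ∀ M M', R M M' → Decr M M') {M M' : Tm}
    (h : Cong R M M') : Decr M M' := by
  induction h with
  | rule h => exact hR _ _ h
  | lam _ ih =>
    exact ih.imp QLt.lam fun ih => ⟨ih.1.lam, by simp only [rk]; omega⟩
  | appL _ ih =>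
    exact ih.imp QLt.appL fun ih => ⟨ih.1.app (QLe.refl _), by simp only [rk]; omega⟩
  | appR _ ih =>
    exact ih.imp QLt.appR fun ih => ⟨(QLe.refl _).app ih.1, by simp only [rk]; omega⟩
  | subL _ ih =>
    exact ih.imp QLt.subL fun ih => ⟨ih.1.sub (QLe.refl _), by
      simp only [rk]; exact Nat.mul_lt_mul_of_pos_right ih.2 (Nat.succ_pos _)⟩
  | @subR M N N' _ ih =>
    exact ih.imp QLt.subR fun ih => ⟨(QLe.refl _).sub ih.1, by
      have := M.two_le_rk
      simp only [rk]; exact Nat.mul_lt_mul_of_pos_left (Nat.succ_lt_succ ih.2) (by omega)⟩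
  | weak _ ih =>
    exact ih.imp QLt.weak fun ih => ⟨ih.1.weak, by simp only [rk]; omega⟩
  | contr _ ih =>
    exact ih.imp QLt.contr fun ih => ⟨ih.1.contr, by simp only [rk]; omega⟩

/-- `M` and `M'` have the same typings and the same `rk`. -/
def QEqv (M M' : Tm) : Prop := QLe M M' ∧ QLe M' M ∧ M.rk = M'.rk

theorem QEqv.of_cong {E : Tm → Tm → Prop} (hE : ∀ M M', E M M' → QEqv M M') {M M' : Tm}
    (h : Cong E M M') : QEqv M M' := by
  induction h with
  | rule h => exact hE _ _ h
  | lam _ ih => exact ⟨ih.1.lam, ih.2.1.lam, by simp only [rk, ih.2.2]⟩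
  | appL _ ih =>
    exact ⟨ih.1.app (QLe.refl _), ih.2.1.app (QLe.refl _), by simp only [rk, ih.2.2]⟩
  | appR _ ih =>
    exact ⟨(QLe.refl _).app ih.1, (QLe.refl _).app ih.2.1, by simp only [rk, ih.2.2]⟩
  | subL _ ih =>
    exact ⟨ih.1.sub (QLe.refl _), ih.2.1.sub (QLe.refl _), by simp only [rk, ih.2.2]⟩
  | subR _ ih =>
    exact ⟨(QLe.refl _).sub ih.1, (QLe.refl _).sub ih.2.1, by simp only [rk, ih.2.2]⟩
  | weak _ ih => exact ⟨ih.1.weak, ih.2.1.weak, by simp only [rk, ih.2.2]⟩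
  | contr _ ih => exact ⟨ih.1.contr, ih.2.1.contr, by simp only [rk, ih.2.2]⟩

theorem QEqv.of_eqvGen {E : Tm → Tm → Prop} (hE : ∀ M M', E M M' → QEqv M M') {M M' : Tm}
    (h : Relation.EqvGen (Cong E) M M') : QEqv M M' := by
  induction h with
  | rel _ _ h => exact QEqv.of_cong hE h
  | refl M => exact ⟨QLe.refl M, QLe.refl M, rfl⟩
  | symm _ _ _ ih => exact ⟨ih.2.1, ih.1, ih.2.2.symm⟩
  | trans _ _ _ _ _ ih₁ ih₂ =>
    exact ⟨ih₁.1.trans ih₂.1, ih₂.2.1.trans ih₁.2.1, ih₁.2.2.trans ih₂.2.2⟩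

/-- Terms with a quantitative typing are strongly normalising for every decreasing system. -/
theorem QTyp.sn {R E : Tm → Tm → Prop} (hR : ∀ M M', R M M' → Decr M M')
    (hE : ∀ M M', E M M' → QEqv M M') {M : Tm} {Γ : MCtx} {F : FTy} {n : ℕ}
    (h : QTyp M Γ F n) : SN (RedMod R E) M := by
  induction n using Nat.strong_induction_on generalizing M with
  | _ n ihn =>
  obtain ⟨k, hk⟩ : ∃ k, M.rk = k := ⟨_, rfl⟩
  -- Lexicographic induction: the bound `n` first, then `rk` at a fixed `n`. The context and the
  -- type never change.
  induction k using Nat.strong_induction_on generalizing M with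
  | _ k ihk =>
  refine Acc.intro _ fun M' ⟨P, Q, hP, hPQ, hQ⟩ => ?_
  have hP := QEqv.of_eqvGen hE hP
  have hQ := QEqv.of_eqvGen hE hQ
  have hM := hP.1 _ _ _ h
  rcases Decr.of_cong hR hPQ with hlt | ⟨hle, hrk⟩
  · obtain ⟨m, hm, hM⟩ := hlt _ _ _ hM
    exact ihn m hm (hQ.1 _ _ _ hM)
  · exact ihk M'.rk (by rw [← hQ.2.2, ← hk, hP.2.2]; exact hrk) (hQ.1 _ _ _ (hle _ _ _ hM)) rfl

-- Composition of renamings, and invariance under the equivalences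

theorem up_comp (r s : ℕ → ℕ) : up (r ∘ s) = up r ∘ up s := by
  funext x; cases x <;> rfl

theorem up_id : up id = id := by
  funext x; cases x <;> rfl

theorem Tm.rename_rename (M : Tm) (r s : ℕ → ℕ) : (M.rename r).rename s = M.rename (s ∘ r) := by
  induction M generalizing r s with
  | _ => simp_all [Tm.rename, up_comp]

theorem Tm.rename_id (M : Tm) : M.rename id = M := by
  induction M with
  | _ => simp_all [Tm.rename, up_id]

theorem Tm.rename_involutive {r : ℕ → ℕ} (hr : ∀ n, r (r n) = n) (M : Tm) :
    (M.rename r).rename r = M := by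
  rw [rename_rename, show r ∘ r = id from funext hr, rename_id]

/-- The renamings in the equivalences `CS`, `CA`, `CC` and `CCC` are involutions, so the converse
inclusion is the direct one read at the renamed term. -/
theorem QLe.symm_of_involutive {r : ℕ → ℕ} (hr : ∀ n, r (r n) = n) {f g : Tm → Tm}
    (h : ∀ M, QLe (f M) (g (M.rename r))) (M : Tm) : QLe (f (M.rename r)) (g M) := by
  simpa only [rename_involutive hr] using h (M.rename r)

theorem LSEq.qeqv {M M' : Tm} (h : LSEq M M') : QEqv M M' := by
  cases h with
  | @CS M N₁ N₂ =>
    exact ⟨QLe.sub_sub_comm,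
      QLe.symm_of_involutive swap01_swap01 (f := fun M => sub (sub M N₂.shift) N₁)
        (g := fun M => sub (sub M N₁.shift) N₂) (fun _ => QLe.sub_sub_comm) M,
      by simp only [rk, rk_rename, rk_shift]; ring⟩

theorem LxrEq.qeqv {M M' : Tm} (h : LxrEq M M') : QEqv M M' := by
  cases h with
  | @CA w M =>
    exact ⟨QLe.contr_assoc,
      QLe.symm_of_involutive (Equiv.swap_apply_self 1 3) (f := fun M => contr w (contr 0 M))
        (g := fun M => contr w (contr 0 M)) (fun _ => QLe.contr_assoc) M,
      by simp only [rk, rk_rename]⟩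
  | @CC x M =>
    exact ⟨QLe.contr_comm,
      QLe.symm_of_involutive swap01_swap01 (f := contr x) (g := contr x)
        (fun _ => QLe.contr_comm) M,
      by simp only [rk, rk_rename]⟩
  | @CCC x x' M =>
    exact ⟨QLe.contr_contr_comm,
      QLe.symm_of_involutive swapPairs_swapPairs (f := fun M => contr x (contr (x' + 2) M))
        (g := fun M => contr x' (contr (x + 2) M)) (fun _ => QLe.contr_contr_comm) M,
      by simp only [rk, rk_rename]⟩
  | WW => exact ⟨QLe.weak_comm, QLe.weak_comm, rfl⟩
  | CS => exact LSEq.qeqv .CS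
  | CSC =>
    exact ⟨QLe.sub_contr, QLe.contr_sub_shift2, by simp only [rk, rk_rename, rk_shift2]; ring⟩

-- Decrease of each reduction rule

theorem Decr.of_qle {M M' : Tm} (h : QLe M M') (h' : M'.rk < M.rk) : Decr M M' := .inr ⟨h, h'⟩

theorem LSRule.decr {M M' : Tm} (h : LSRule M M') : Decr M M' := by
  cases h with
  | B => exact .inl QLt.beta
  | @W y N => exact .of_qle QLe.sub_var_succ (by have := N.two_le_rk; simp only [rk]; omega)
  | SR => exact .of_qle QLe.sub_var_zero (by simp only [rk]; omega)
  | app₁ h₁ h₂ => exact .inl (QLt.sub_app h₁ h₂)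
  | @app₂ M₁ M₂ N h =>
    refine .of_qle (QLe.sub_app_right h) ?_
    have := M₁.two_le_rk; have := N.two_le_rk
    simp only [rk, rk_shift]; nlinarith
  | @app₃ M₁ M₂ N =>
    refine .of_qle QLe.sub_app_left ?_
    have := M₂.two_le_rk; have := N.two_le_rk
    simp only [rk, rk_shift]; nlinarith
  | @lam M N =>
    refine .of_qle QLe.sub_lam ?_
    have := M.two_le_rk; have := N.two_le_rk
    simp only [rk, rk_shift, rk_rename]; nlinarith
  | sub₁ h₁ h₂ => exact .inl (QLt.sub_sub h₁ h₂)
  | @sub₂ M₁ M₂ N h =>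
    refine .of_qle (QLe.sub_comp h) ?_
    have h₁ := M₁.two_le_rk; have h₂ := N.two_le_rk
    simp only [rk, rk_rename]
    nlinarith [Nat.mul_le_mul h₁ h₂]

theorem LxrRule.decr {M M' : Tm} (h : LxrRule M M') : Decr M M' := by
  cases h with
  | B => exact LSRule.B.decr
  | SR => exact LSRule.SR.decr
  | SPapp₁ => exact LSRule.app₃.decr
  | SPapp₂ h => exact (LSRule.app₂ h).decr
  | SPlam => exact LSRule.lam.decr
  | @SPweak y M N =>
    refine .of_qle QLe.sub_weak_succ ?_
    have := N.two_le_rk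
    simp only [rk]; nlinarith
  | W _ hX => exact .inl (QLt.sub_weak_zero hX)
  | D hX hN => exact .inl (QLt.sub_contr_zero hX hN)
  | comp h => exact (LSRule.sub₂ h).decr
  | WAbs => exact .of_qle QLe.lam_weak (by simp only [rk]; omega)
  | WApp₁ => exact .of_qle QLe.app_weak_left (by simp only [rk]; omega)
  | WApp₂ => exact .of_qle QLe.app_weak_right (by simp only [rk]; omega)
  | @WSubs y M N =>
    refine .of_qle QLe.sub_weak_right ?_
    have := M.two_le_rk
    simp only [rk]; nlinarith
  | Merge => exact .of_qle QLe.contr_weak_zero (by simp only [rk, rk_shift, rk_rename]; omega)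
  | @Cross w x M =>
    exact .of_qle QLe.contr_weak (by have := M.two_le_rk; simp only [rk]; omega)
  | CAbs => exact .of_qle QLe.contr_lam (by simp only [rk, rk_rename]; omega)
  | @CApp₁ w M N =>
    refine .of_qle QLe.contr_app_left ?_
    have := N.two_le_rk
    simp only [rk, rk_shift2]; omega
  | @CApp₂ w M N h0 h1 =>
    refine .of_qle (QLe.contr_app_right h0 h1) ?_
    have := M.two_le_rk
    simp only [rk, rk_shift2]; omega
  | @CSubs w M N h0 h1 =>
    refine .of_qle (QLe.contr_sub h0 h1) ?_
    have := M.two_le_rk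
    simp only [rk, rk_rename]; nlinarith

/-! ### From intersection types to quantitative types -/

/-- The multiset of the `F`-types of which a `U`-type is the intersection. -/
def UTy.toM : UTy → Multiset FTy
  | none => 0
  | some A => A.toM

theorem UTy.toM_inter : ∀ U V : UTy, (UTy.inter U V).toM = U.toM + V.toM
  | some _, some _ => rfl
  | some _, none => (add_zero _).symm
  | none, _ => (zero_add _).symm

theorem AEqv.toM_eq {A B : ATy} (h : AEqv A B) : A.toM = B.toM := by
  induction h with
  | refl => rfl
  | comm => exact add_comm _ _
  | congr _ _ ih₁ ih₂ => simp only [ATy.toM, ih₁, ih₂]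
  | trans _ _ ih₁ ih₂ => exact ih₁.trans ih₂
  | assoc => exact add_assoc _ _ _
  | assoc' => exact (add_assoc _ _ _).symm

theorem USub.toM_le {U V : UTy} (h : USub U V) : V.toM ≤ U.toM := by
  obtain ⟨W, h⟩ := h
  have : U.toM = V.toM + W.toM := by
    rw [← UTy.toM_inter]
    revert h
    generalize UTy.inter V W = T
    rcases U with _ | A <;> rcases T with _ | B <;> intro h
    · rfl
    · exact h.elim
    · exact h.elim
    · exact AEqv.toM_eq h
  exact this ▸ Multiset.le_add_right _ _

/-- The context of multisets that corresponds to a context of `U`-types. -/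
def Ctx.toM (Γ : Ctx) : MCtx := fun x => (Γ x).toM

theorem Ctx.toM_inter (Γ Δ : Ctx) : (Γ.inter Δ).toM = Γ.toM + Δ.toM :=
  funext fun _ => UTy.toM_inter _ _

theorem Ctx.toM_scons (U : UTy) (Γ : Ctx) : Ctx.toM (scons U Γ) = scons U.toM Γ.toM := by
  funext x; cases x <;> rfl

theorem Ctx.toM_single (x : ℕ) (U : UTy) : (Ctx.single x U).toM = MCtx.single x U.toM := by
  funext y
  by_cases h : y = x
  · subst h; simp [Ctx.toM, Ctx.single]
  · simp [Ctx.toM, Ctx.single, h, UTy.toM]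

/-- Every contraction of the term binds two variables that do occur. -/
def Tm.ContrOccurs : Tm → Prop
  | .var _ => True
  | .lam M => M.ContrOccurs
  | .app M N => M.ContrOccurs ∧ N.ContrOccurs
  | .sub M N => M.ContrOccurs ∧ N.ContrOccurs
  | .weak _ M => M.ContrOccurs
  | .contr _ M => M.ContrOccurs ∧ 0 ∈ M.fv ∧ 1 ∈ M.fv

theorem Tm.IsLinear.contrOccurs {M : Tm} (h : M.IsLinear) : M.ContrOccurs := by
  induction M with
  | _ => simp_all [IsLinear, ContrOccurs]

theorem Tm.IsLS.contrOccurs {M : Tm} (h : M.IsLS) : M.ContrOccurs := by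
  induction M with
  | _ => simp_all [IsLS, ContrOccurs]

/-- `Typ` lets a contracted variable have type `ω`, whereas `QTyp` demands non-empty multisets;
`ContrOccurs` closes this gap through `QTyp.ne_zero`. -/
theorem Typ.exists_multi {Γ : Ctx} {M : Tm} {U : UTy} (h : Typ Γ M U) (hM : M.ContrOccurs) :
    ∃ n, Multi (QTyp M) Γ.toM U.toM n := by
  induction h with
  | var x F =>
    refine ⟨1, Multi.single ⟨?_, one_pos⟩⟩
    rw [Ctx.toM_single]
    simp [UTy.toM, ATy.toM]
  | @abs Γ U M A F _ hU ih =>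
    obtain ⟨n, ih⟩ := ih hM
    rw [Ctx.toM_scons] at ih
    obtain ⟨R, hR⟩ := exists_add_of_le hU.toM_le
    have := (QTyp.of_multi_singleton ih).mono (scons R 0) le_rfl
    rw [← scons_add, add_zero, ← hR] at this
    exact ⟨n, Multi.single ⟨A, F, rfl, this⟩⟩
  | @app Γ Δ M N A F _ _ ih₁ ih₂ =>
    obtain ⟨n₁, ih₁⟩ := ih₁ hM.1
    obtain ⟨n₂, ih₂⟩ := ih₂ hM.2
    exact ⟨_, Multi.single ⟨A, _, _, n₁, n₂, Ctx.toM_inter _ _, le_rfl,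
      QTyp.of_multi_singleton ih₁, ih₂⟩⟩
  | inter _ _ ih₁ ih₂ =>
    obtain ⟨n₁, ih₁⟩ := ih₁ hM
    obtain ⟨n₂, ih₂⟩ := ih₂ hM
    exact ⟨_, Ctx.toM_inter _ _ ▸ ih₁.add ih₂⟩
  | omega M => exact ⟨0, Multi.zero _ _⟩
  | @sub Γ Δ M N A U F _ _ hU ih₁ ih₂ =>
    obtain ⟨n₁, ih₁⟩ := ih₁ hM.2
    obtain ⟨n₂, ih₂⟩ := ih₂ hM.1
    -- When `U` is `ω`, the argument is nevertheless typed by `A`, so the body is weakened by `A` to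
    -- match.
    have h₂ : QTyp M (scons A.toM Δ.toM) F n₂ := by
      rw [Ctx.toM_scons] at ih₂
      rcases hU with rfl | rfl
      · exact QTyp.of_multi_singleton ih₂
      · have := (QTyp.of_multi_singleton ih₂).mono (scons A.toM 0) le_rfl
        rw [← scons_add, add_zero] at this
        rwa [show UTy.toM none = 0 from rfl, zero_add] at this
    exact ⟨_, Multi.single ⟨A.toM, _, _, n₂, n₁, A.toM_ne_zero,
      (Ctx.toM_inter _ _).trans (add_comm _ _), Nat.le_succ _, h₂, ih₁⟩⟩
  | @contr Γ x V₁ V₂ M F _ ih =>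
    obtain ⟨n, ih⟩ := ih hM.1
    rw [Ctx.toM_scons, Ctx.toM_scons] at ih
    have ih := QTyp.of_multi_singleton ih
    refine ⟨n, Multi.single ⟨_, _, _, ih.ne_zero hM.2.1, ih.ne_zero hM.2.2, ?_, ih⟩⟩
    rw [Ctx.toM_inter, Ctx.toM_single, UTy.toM_inter]; rfl
  | @weak Γ x A M F _ ih =>
    obtain ⟨n, ih⟩ := ih hM
    refine ⟨n, Multi.single ?_⟩
    rw [Ctx.toM_inter, Ctx.toM_single]
    refine ⟨?_, (QTyp.of_multi_singleton ih).mono _ le_rfl⟩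
    simp [UTy.toM, A.toM_ne_zero]

theorem Typ.exists_qtyp {Γ : Ctx} {M : Tm} {A : ATy} (h : Typ Γ M (some A))
    (hM : M.ContrOccurs) : ∃ Γ F n, QTyp M Γ F n := by
  obtain ⟨n, h⟩ := h.exists_multi hM
  obtain ⟨F, hF⟩ := Multiset.exists_mem_of_ne_zero A.toM_ne_zero
  exact ⟨_, F, n, QTyp.of_multi_mem h hF⟩

theorem Typ.snLS {Γ : Ctx} {M : Tm} {A : ATy} (h : Typ Γ M (some A)) (hM : M.IsLS) : SNLS M :=
  let ⟨_, _, _, h⟩ := h.exists_qtyp hM.contrOccurs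
  h.sn (fun _ _ => LSRule.decr) fun _ _ => LSEq.qeqv

theorem Typ.snLxr {Γ : Ctx} {M : Tm} {A : ATy} (h : Typ Γ M (some A)) (hM : M.IsLinear) :
    SNLxr M :=
  let ⟨_, _, _, h⟩ := h.exists_qtyp hM.contrOccurs
  h.sn (fun _ _ => LxrRule.decr) fun _ _ => LxrEq.qeqv

/-! ### Simulation of `β`-reduction in `λS` -/

theorem upS_scons_var : upS var = var := by
  funext x; cases x <;> rfl

theorem Tm.subst_var (M : Tm) : M.subst var = M := by
  induction M with
  | _ => simp_all [Tm.subst, upS_scons_var]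

theorem upS_comp_up (s : ℕ → Tm) (r : ℕ → ℕ) : upS (s ∘ r) = upS s ∘ up r := by
  funext x; cases x <;> rfl

theorem Tm.IsPure.subst_rename {M : Tm} (h : M.IsPure) (r : ℕ → ℕ) (s : ℕ → Tm) :
    (M.rename r).subst s = M.subst (s ∘ r) := by
  induction M generalizing r s with
  | weak => exact h.elim
  | contr => exact h.elim
  | _ => simp_all [Tm.rename, Tm.subst, upS_comp_up, IsPure]

theorem Tm.IsPure.rename {M : Tm} (h : M.IsPure) (r : ℕ → ℕ) : (M.rename r).IsPure := by
  induction M generalizing r with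
  | _ => simp_all [Tm.rename, IsPure]

theorem Tm.IsPure.isLS {M : Tm} (h : M.IsPure) : M.IsLS := by
  induction M with
  | _ => simp_all [IsLS, IsPure]

theorem Tm.IsPure.rename_congr {M : Tm} (h : M.IsPure) {r s : ℕ → ℕ}
    (hrs : ∀ x ∈ M.fv, r x = s x) : M.rename r = M.rename s := by
  induction M generalizing r s with
  | var x => exact congrArg var (hrs x (Finset.mem_singleton_self x))
  | lam M ih =>
    refine congrArg Tm.lam (ih h ?_)
    rintro (_ | x) hx
    · rfl
    · exact congrArg Nat.succ (hrs x (mem_unbind.2 hx))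
  | app M N ih₁ ih₂ =>
    exact congrArg₂ Tm.app (ih₁ h.1 fun x hx => hrs x (Finset.mem_union_left _ hx))
      (ih₂ h.2 fun x hx => hrs x (Finset.mem_union_right _ hx))
  | sub => exact h.elim
  | weak => exact h.elim
  | contr => exact h.elim

/-- `Nat.pred` undoes the shift on every index but `0`, and renaming depends only on free variables.
-/
theorem Tm.IsPure.exists_eq_shift {M : Tm} (h : M.IsPure) (h0 : 0 ∉ M.fv) :
    ∃ P : Tm, M = P.shift ∧ ∀ N, M.inst N = P := by
  suffices e : M = (M.rename Nat.pred).shift by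
    refine ⟨M.rename Nat.pred, e, fun N => ?_⟩
    conv_lhs => rw [e]
    rw [shift, inst, (h.rename _).subst_rename]
    exact (M.rename Nat.pred).subst_var
  rw [shift, rename_rename]
  conv_lhs => rw [← M.rename_id]
  refine h.rename_congr fun x hx => ?_
  have : x ≠ 0 := fun e => h0 (e ▸ hx)
  simp only [id, Function.comp, Nat.pred_eq_sub_one]
  omega

open Relation in
-- Pushing a substitution under `λ` exchanges two indices, so the new body is only a renaming of a
-- subterm; quantifying over `r` keeps the induction structural.
theorem Tm.IsPure.sub_reduces_inst {M : Tm} (h : M.IsPure) (r : ℕ → ℕ) (N : Tm) :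
    ReflTransGen (Cong LSRule) (sub (M.rename r) N) ((M.rename r).inst N) := by
  induction M generalizing r N with
  | var x =>
    change ReflTransGen _ (sub (var (r x)) N) (scons N var (r x))
    rcases r x with _ | y
    · exact .single (.rule .SR)
    · exact .single (.rule .W)
  | lam M ih =>
    have key := ih h (swap01 ∘ up r) N.shift
    rw [← rename_rename] at key
    have e : ((M.rename (up r)).rename swap01).inst N.shift =
        (M.rename (up r)).subst (upS (scons N var)) := by
      rw [inst, (IsPure.rename (M := M) h (up r)).subst_rename]
      congr 1
      funext x
      rcases x with _ | _ | x
      · rfl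
      · rfl
      · simp [upS, shift, Tm.rename]
    rw [e] at key
    exact .head (.rule .lam) (ReflTransGen.lift Tm.lam (fun _ _ => Cong.lam) _ _ key)
  | app M₁ M₂ ih₁ ih₂ =>
    have ih₁ := ih₁ h.1 r N
    have ih₂ := ih₂ h.2 r N
    change ReflTransGen _ (sub (app (M₁.rename r) (M₂.rename r)) N)
      (app ((M₁.rename r).inst N) ((M₂.rename r).inst N))
    -- The three rules for applications are told apart by where the variable occurs; a side without
    -- it is a shift, which instantiation leaves as it was.
    by_cases h₂ : 0 ∈ (M₂.rename r).fv
    · have ih₂ : ∀ P, ReflTransGen (Cong LSRule) (app P (sub (M₂.rename r) N))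
          (app P ((M₂.rename r).inst N)) := fun P => ReflTransGen.lift (app P) (fun _ _ => Cong.appR) _ _ ih₂
      by_cases h₁ : 0 ∈ (M₁.rename r).fv
      · exact .head (.rule (.app₁ h₁ h₂))
          ((ReflTransGen.lift (app · _) (fun _ _ => Cong.appL) _ _ ih₁).trans (ih₂ _))
      · obtain ⟨P, hP, hi⟩ := (IsPure.rename h.1 r).exists_eq_shift h₁
        rw [hi, hP]
        exact .head (.rule (.app₂ h₂)) (ih₂ P)
    · obtain ⟨P, hP, hi⟩ := (IsPure.rename h.2 r).exists_eq_shift h₂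
      rw [hi, hP]
      exact .head (.rule .app₃) (ReflTransGen.lift (app · _) (fun _ _ => Cong.appL) _ _ ih₁)
  | sub => exact h.elim
  | weak => exact h.elim
  | contr => exact h.elim

open Relation in
theorem BetaRule.simulation {M M' : Tm} (h : BetaRule M M') : TransGen (Cong LSRule) M M' := by
  cases h with
  | @beta M N hM hN =>
    have := hM.sub_reduces_inst id N
    rw [rename_id] at this
    exact .head' (.rule .B) this

open Relation in
theorem Cong.beta_simulation {M M' : Tm} (h : Cong BetaRule M M') :
    TransGen (Cong LSRule) M M' := by
  induction h with
  | rule h => exact h.simulation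
  | lam _ ih => exact TransGen.lift Tm.lam (fun _ _ => Cong.lam) _ _ ih
  | appL _ ih => exact TransGen.lift (app · _) (fun _ _ => Cong.appL) _ _ ih
  | appR _ ih => exact TransGen.lift (app _) (fun _ _ => Cong.appR) _ _ ih
  | subL _ ih => exact TransGen.lift (sub · _) (fun _ _ => Cong.subL) _ _ ih
  | subR _ ih => exact TransGen.lift (sub _) (fun _ _ => Cong.subR) _ _ ih
  | weak _ ih => exact TransGen.lift (Tm.weak _) (fun _ _ => Cong.weak) _ _ ih
  | contr _ ih => exact TransGen.lift (Tm.contr _) (fun _ _ => Cong.contr) _ _ ih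

theorem Cong.redMod {R E : Tm → Tm → Prop} {M M' : Tm} (h : Cong R M M') : RedMod R E M M' :=
  ⟨M, M', .refl _, h, .refl _⟩

/-- Accessibility passes to the transitive closure, which contains reversed `β` by the simulation.
-/
theorem SNLS.snLambda {M : Tm} (h : SNLS M) : SNLambda M := by
  have h' : Acc (Relation.TransGen fun a b => RedMod LSRule LSEq b a) M := h.transGen
  refine Subrelation.accessible (fun {a b} hab => ?_) h'
  rw [Relation.transGen_swap]
  exact Relation.TransGen.mono (fun _ _ => Cong.redMod) _ _ (Cong.beta_simulation hab)

/-! ### The model of I-filters -/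

theorem IFilter.ne_bot_iff {u : IFilter} : u ≠ ⊥ ↔ ∃ A, A ∈ u := by
  constructor
  · intro h
    by_contra hc
    refine h (IFilter.ext (Set.eq_empty_iff_forall_notMem.2 fun A hA => hc ⟨A, hA⟩))
  · rintro ⟨A, hA⟩ rfl
    exact hA

theorem IFilter.mem_gen_of_mem {S : Set ATy} {A : ATy} (h : A ∈ S) : A ∈ IFilter.gen S :=
  fun _ hv => hv h

theorem IFilter.gen_le {S : Set ATy} {v : IFilter} (h : S ⊆ v.carrier) :
    (IFilter.gen S).carrier ⊆ v.carrier := fun _ hA => hA v h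

theorem IFilter.ap_mono {u u' v v' : IFilter} (h : u.carrier ⊆ u'.carrier)
    (h' : v.carrier ⊆ v'.carrier) : (u.ap v).carrier ⊆ (u'.ap v').carrier := by
  refine IFilter.gen_le ?_
  rintro _ ⟨F, rfl, A, hA, hF⟩
  exact IFilter.mem_gen_of_mem ⟨F, rfl, A, h' hA, h hF⟩

theorem IFilter.bot_ap (v : IFilter) : (⊥ : IFilter).ap v = ⊥ := by
  by_contra h
  obtain ⟨A, hA⟩ := IFilter.ne_bot_iff.1 h
  exact hA ⊥ (by rintro _ ⟨F, rfl, A, -, hF⟩; exact hF)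

theorem IFilter.ne_bot_mono {u v : IFilter} (h : u.carrier ⊆ v.carrier) (hu : u ≠ ⊥) : v ≠ ⊥ := by
  obtain ⟨A, hA⟩ := IFilter.ne_bot_iff.1 hu
  exact IFilter.ne_bot_iff.2 ⟨A, h hA⟩

theorem apList_mono {vs : List Value} {u u' : IFilter} (h : u.carrier ⊆ u'.carrier) :
    (apList u vs).carrier ⊆ (apList u' vs).carrier := by
  induction vs generalizing u u' with
  | nil => exact h
  | cons v vs ih => exact ih (IFilter.ap_mono h subset_rfl)

theorem apList_bot (vs : List Value) : apList ⊥ vs = ⊥ := by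
  induction vs with
  | nil => rfl
  | cons v vs ih => rw [apList, List.foldl_cons, IFilter.bot_ap]; exact ih

theorem ne_bot_of_apList {u : IFilter} {vs : List Value} (h : apList u vs ≠ ⊥) : u ≠ ⊥ := by
  rintro rfl
  exact h (apList_bot vs)

theorem IFilter.top_ne_bot : (⊤ : IFilter) ≠ ⊥ :=
  IFilter.ne_bot_iff.2 ⟨.ofF (.atom 0), trivial⟩

theorem IFilter.mem_of_ofF {v : IFilter} (h : ∀ F, ATy.ofF F ∈ v) : ∀ A, A ∈ v
  | .ofF F => h F
  | .inter A B => v.inter_mem (IFilter.mem_of_ofF h A) (IFilter.mem_of_ofF h B)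

/-- `⊤` contains `A → F` for every `F`, so one `A` in `v` suffices. As a consequence `⊤` is
orthogonal to every list and realises every type. -/
theorem IFilter.top_ap {v : IFilter} (hv : v ≠ ⊥) : (⊤ : IFilter).ap v = ⊤ := by
  obtain ⟨A, hA⟩ := IFilter.ne_bot_iff.1 hv
  refine IFilter.ext (Set.eq_univ_of_forall (IFilter.mem_of_ofF fun F => ?_))
  exact IFilter.mem_gen_of_mem ⟨F, rfl, A, hA, trivial⟩

theorem apList_top (vs : List Value) : apList ⊤ vs = ⊤ := by
  induction vs with
  | nil => rfl
  | cons v vs ih => rw [apList, List.foldl_cons, IFilter.top_ap v.2]; exact ih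

/-- The value of all `A`-types. -/
def Value.top : Value := ⟨⊤, IFilter.top_ne_bot⟩

theorem Value.top_mem_semP (A : STy) (σ : Valuation) : Value.top ∈ semP A σ := fun vs _ => by
  change apList ⊤ vs ≠ ⊥
  rw [apList_top]
  exact IFilter.top_ne_bot

/-- This is where non-empty valuations matter: orthogonality to the empty set would say nothing
about a filter. It also makes every type a legitimate instance of a quantified variable. -/
theorem semN_nonempty (A : STy) (σ : Valuation) : (semN A σ).Nonempty := by
  induction A generalizing σ with
  | tvar α => exact (σ α).2
  | arr A B _ ih =>
    obtain ⟨vs, hvs⟩ := ih σ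
    exact ⟨_, Value.top, Value.top_mem_semP A σ, vs, hvs, rfl⟩
  | inter A B ih _ => exact (ih σ).mono Set.subset_union_left
  | all A ih =>
    obtain ⟨vs, hvs⟩ := ih (scons ⟨Set.univ, Set.univ_nonempty⟩ σ)
    exact ⟨vs, Set.mem_iUnion.2 ⟨_, hvs⟩⟩

theorem semN_rename (A : STy) (r : ℕ → ℕ) (σ : Valuation) :
    semN (A.rename r) σ = semN A (fun α => σ (r α)) := by
  induction A generalizing r σ with
  | tvar α => rfl
  | arr A B ih₁ ih₂ => simp only [STy.rename, semN, ih₁, ih₂]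
  | inter A B ih₁ ih₂ => simp only [STy.rename, semN, ih₁, ih₂]
  | all A ih =>
    simp only [STy.rename, semN, ih]
    refine Set.iUnion_congr fun Y => congrArg (semN A) ?_
    funext α; cases α <;> rfl

theorem semN_shift (A : STy) (Y : {Y : Set (List Value) // Y.Nonempty}) (σ : Valuation) :
    semN A.shift (scons Y σ) = semN A σ := semN_rename _ _ _

/-- The negative interpretation of a type, as a value of a type variable. -/
def semN' (A : STy) (σ : Valuation) : {Y : Set (List Value) // Y.Nonempty} :=
  ⟨semN A σ, semN_nonempty A σ⟩

theorem semN_subst (A : STy) (s : ℕ → STy) (σ : Valuation) :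
    semN (A.subst s) σ = semN A (fun α => semN' (s α) σ) := by
  induction A generalizing s σ with
  | tvar α => rfl
  | arr A B ih₁ ih₂ => simp only [STy.subst, semN, ih₁, ih₂]
  | inter A B ih₁ ih₂ => simp only [STy.subst, semN, ih₁, ih₂]
  | all A ih =>
    simp only [STy.subst, semN, ih]
    refine Set.iUnion_congr fun Y => congrArg (semN A) ?_
    funext α
    cases α with
    | zero => rfl
    | succ α => exact Subtype.ext (semN_shift (s α) Y σ)

theorem semN_inst (A B : STy) (σ : Valuation) :
    semN (A.inst B) σ = semN A (scons (semN' B σ) σ) := by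
  rw [STy.inst, semN_subst]
  congr 1
  funext α; cases α <;> rfl

/-! ### Adequacy -/

theorem Compat.scons {U : UTy} {Γ : Ctx} {u : IFilter} {ρ : Env} :
    Compat (scons U Γ) (ESub.scons u ρ) ↔ (∀ A, U = some A → A ∈ u) ∧ Compat Γ ρ :=
  ⟨fun h => ⟨h 0, fun x => h (x + 1)⟩, fun h x => by
    cases x with
    | zero => exact h.1
    | succ x => exact h.2 x⟩

theorem Compat.single {x : ℕ} {U : UTy} {ρ : Env} :
    Compat (Ctx.single x U) ρ ↔ ∀ A, U = some A → A ∈ ρ x := by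
  constructor
  · intro h A hA
    exact h x A (by simp [Ctx.single, hA])
  · intro h y A hA
    by_cases e : y = x
    · subst e; exact h A (by simpa [Ctx.single] using hA)
    · simp [Ctx.single, e] at hA

theorem exists_compat_scons {u : IFilter} {ρ : Env} {Γ : Ctx} (h : Compat Γ (scons u ρ)) :
    ∃ U Δ, Γ = scons U Δ ∧ (∀ A, U = some A → A ∈ u) ∧ Compat Δ ρ := by
  obtain ⟨U, Δ, rfl⟩ := exists_eq_scons Γ
  exact ⟨U, Δ, rfl, Compat.scons.1 h⟩

/-- Membership of an intersection in a filter reduces to that of its components, so `F`-types are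
enough; these are the types concluded by the rules for constructors. -/
theorem interp_subset {M : Tm} {ρ : Env} {v : IFilter}
    (h : ∀ Γ F, Compat Γ ρ → Typ Γ M (some (.ofF F)) → ATy.ofF F ∈ v) :
    ∀ A ∈ interp M ρ, A ∈ v
  | .ofF F, ⟨Γ, hΓ, hM⟩ => h Γ F hΓ hM
  | .inter A B, hM =>
    let ⟨h₁, h₂⟩ := IFilter.mem_inter.1 hM
    v.inter_mem (interp_subset h A h₁) (interp_subset h B h₂)

theorem interp_var_superset (x : ℕ) (ρ : Env) : ∀ A ∈ ρ x, A ∈ interp (var x) ρ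
  | .ofF F, hA => ⟨_, Compat.single.2 fun _ e => Option.some.inj e ▸ hA, Typ.var x F⟩
  | .inter A B, hA =>
    let ⟨h₁, h₂⟩ := IFilter.mem_inter.1 hA
    (interp (var x) ρ).inter_mem (interp_var_superset x ρ A h₁) (interp_var_superset x ρ B h₂)

theorem interp_app_superset (M N : Tm) (ρ : Env) :
    ((interp M ρ).ap (interp N ρ)).carrier ⊆ (interp (app M N) ρ).carrier := by
  refine IFilter.gen_le ?_
  rintro _ ⟨F, rfl, A, ⟨Δ, hΔ, hN⟩, ⟨Γ, hΓ, hM⟩⟩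
  exact ⟨_, Compat.inter_iff.2 ⟨hΓ, hΔ⟩, hM.app hN⟩

theorem USub.some_none (A : ATy) : USub (some A) none := ⟨some A, AEqv.rfl A⟩

/-- When the body does not use its variable (`U = ω`), the rule for `λ` still asks for an `A`-type
as domain; it is taken from the non-empty `u`. -/
theorem interp_lam_superset (M : Tm) (ρ : Env) {u : IFilter} (hu : u ≠ ⊥) :
    (interp M (scons u ρ)).carrier ⊆ ((interp (lam M) ρ).ap u).carrier := by
  refine interp_subset fun Γ F hΓ hM => ?_
  obtain ⟨U, Δ, rfl, hU, hΔ⟩ := exists_compat_scons hΓ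
  obtain ⟨A, hA, hAU⟩ : ∃ A, A ∈ u ∧ USub (some A) U := by
    rcases U with _ | A
    · obtain ⟨A, hA⟩ := IFilter.ne_bot_iff.1 hu
      exact ⟨A, hA, USub.some_none A⟩
    · exact ⟨A, hU A rfl, none, AEqv.rfl A⟩
  exact IFilter.mem_gen_of_mem ⟨F, rfl, A, hA, Δ, hΔ, hM.abs hAU⟩

theorem interp_sub_superset (M : Tm) {N : Tm} {ρ : Env} (hN : interp N ρ ≠ ⊥) :
    (interp M (scons (interp N ρ) ρ)).carrier ⊆ (interp (sub M N) ρ).carrier := by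
  refine interp_subset fun Γ F hΓ hM => ?_
  obtain ⟨U, Δ, rfl, hU, hΔ⟩ := exists_compat_scons hΓ
  obtain ⟨A, ⟨Θ, hΘ, hA⟩, hAU⟩ : ∃ A, A ∈ interp N ρ ∧ (U = some A ∨ U = none) := by
    rcases U with _ | A
    · obtain ⟨A, hA⟩ := IFilter.ne_bot_iff.1 hN
      exact ⟨A, hA, .inr rfl⟩
    · exact ⟨A, hU A rfl, .inl rfl⟩
  exact ⟨_, Compat.inter_iff.2 ⟨hΘ, hΔ⟩, hA.sub hM hAU⟩

theorem interp_weak_superset (x : ℕ) (M : Tm) {ρ : Env} (hx : ρ x ≠ ⊥) :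
    (interp M ρ).carrier ⊆ (interp (weak x M) ρ).carrier := by
  refine interp_subset fun Γ F hΓ hM => ?_
  obtain ⟨A, hA⟩ := IFilter.ne_bot_iff.1 hx
  exact ⟨_, Compat.inter_iff.2 ⟨hΓ, Compat.single.2 fun B e => Option.some.inj e ▸ hA⟩, hM.weak⟩

theorem interp_contr_superset (x : ℕ) (M : Tm) (ρ : Env) :
    (interp M (scons (ρ x) (scons (ρ x) ρ))).carrier ⊆ (interp (contr x M) ρ).carrier := by
  refine interp_subset fun Γ F hΓ hM => ?_
  obtain ⟨V₁, Γ, rfl, h₁, hΓ⟩ := exists_compat_scons hΓ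
  obtain ⟨V₂, Γ, rfl, h₂, hΓ⟩ := exists_compat_scons hΓ
  refine ⟨_, Compat.inter_iff.2 ⟨hΓ, Compat.single.2 fun A e => ?_⟩, hM.contr⟩
  rcases V₁ with _ | A₁ <;> rcases V₂ with _ | A₂ <;> simp only [UTy.inter] at e
  · cases e
  · exact h₂ A e
  · exact h₁ A e
  · exact Option.some.inj e ▸ IFilter.mem_inter.2 ⟨h₁ _ rfl, h₂ _ rfl⟩

/-- The reason why inclusions between interpretations are enough for adequacy. -/
theorem mem_semP_mono {A : STy} {σ : Valuation} {u v : IFilter} (h : u.carrier ⊆ v.carrier)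
    (hu : ∀ vs ∈ semN A σ, apList u vs ≠ ⊥) : ∀ vs ∈ semN A σ, apList v vs ≠ ⊥ :=
  fun vs hvs => IFilter.ne_bot_mono (apList_mono h) (hu vs hvs)

theorem ne_bot_of_semN {A : STy} {σ : Valuation} {u : IFilter}
    (h : ∀ vs ∈ semN A σ, apList u vs ≠ ⊥) : u ≠ ⊥ := by
  obtain ⟨vs, hvs⟩ := semN_nonempty A σ
  exact ne_bot_of_apList (h vs hvs)

theorem CtxSem.scons {Γ : SCtx} {σ : Valuation} {ρ : Env} (hρ : ρ ∈ CtxSem Γ σ) {A : STy}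
    {u : Value} (hu : u ∈ semP A σ) : ESub.scons u.1 ρ ∈ CtxSem (ESub.scons (some A) Γ) σ := by
  rintro (_ | x) B hB
  · exact ⟨u, Option.some.inj hB ▸ hu, rfl⟩
  · exact hρ x B hB

theorem CtxSem.of_update {Γ : SCtx} {x : ℕ} {A : STy} {σ : Valuation} {ρ : Env}
    (hρ : ρ ∈ CtxSem (Function.update Γ x (some A)) σ) (hx : Γ x = none) :
    ρ ∈ CtxSem Γ σ ∧ ∃ u ∈ semP A σ, ρ x = u.1 := by
  refine ⟨fun y B hB => hρ y B ?_, hρ x A (Function.update_self ..)⟩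
  rwa [Function.update_of_ne]
  rintro rfl
  rw [hx] at hB
  cases hB

/-- Stated on filters, before they are known to be values; non-emptiness then follows from
`ne_bot_of_semN`, and is needed inside the induction so that arguments may appear in lists of
values. -/
theorem STyp.adequacy {Γ : SCtx} {M : Tm} {A : STy} (h : STyp Γ M A) :
    ∀ {σ : Valuation} {ρ : Env}, ρ ∈ CtxSem Γ σ → ∀ vs ∈ semN A σ, apList (interp M ρ) vs ≠ ⊥ := by
  induction h with
  | @var Γ x A hx =>
    intro σ ρ hρ
    obtain ⟨u, hu, e⟩ := hρ x A hx
    exact mem_semP_mono (interp_var_superset x ρ) (e ▸ hu)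
  | abs _ ih =>
    rintro σ ρ hρ _ ⟨u, hu, vs, hvs, rfl⟩
    exact mem_semP_mono (interp_lam_superset _ ρ u.2) (ih (CtxSem.scons hρ hu)) vs hvs
  | @app Γ M N A B _ _ ih₁ ih₂ =>
    intro σ ρ hρ
    have hN := ih₂ hρ
    exact mem_semP_mono (interp_app_superset M N ρ) fun vs hvs =>
      ih₁ hρ _ ⟨⟨interp N ρ, ne_bot_of_semN hN⟩, hN, vs, hvs, rfl⟩
  | interI _ _ ih₁ ih₂ =>
    rintro σ ρ hρ vs (hvs | hvs)
    · exact ih₁ hρ vs hvs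
    · exact ih₂ hρ vs hvs
  | interE₁ _ ih => exact fun hρ vs hvs => ih hρ vs (.inl hvs)
  | interE₂ _ ih => exact fun hρ vs hvs => ih hρ vs (.inr hvs)
  | @allI Γ M A _ ih =>
    intro σ ρ hρ vs hvs
    obtain ⟨Y, hvs⟩ := Set.mem_iUnion.1 hvs
    refine ih (σ := scons Y σ) (fun x B hB => ?_) vs hvs
    obtain ⟨C, hC, rfl⟩ := Option.map_eq_some_iff.1 hB
    obtain ⟨u, hu, e⟩ := hρ x C hC
    refine ⟨u, ?_, e⟩
    rwa [semP, semN_shift]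
  | @allE Γ M A B _ ih =>
    intro σ ρ hρ vs hvs
    rw [semN_inst] at hvs
    -- The union over all non-empty sets is instantiated at the negative interpretation of `B`.
    exact ih hρ vs (Set.mem_iUnion.2 ⟨_, hvs⟩)
  | @sub Γ M N A B _ _ ih₁ ih₂ =>
    intro σ ρ hρ
    have hN := ih₁ hρ
    have hb := ne_bot_of_semN hN
    exact mem_semP_mono (interp_sub_superset M hb)
      (ih₂ (CtxSem.scons hρ (u := ⟨interp N ρ, hb⟩) hN))
  | @weak Γ x M A B _ hx ih =>
    intro σ ρ hρ
    obtain ⟨hρ, u, -, e⟩ := CtxSem.of_update hρ hx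
    exact mem_semP_mono (interp_weak_superset x M (e ▸ u.2)) (ih hρ)
  | @contr Γ x M A B _ hx ih =>
    intro σ ρ hρ
    obtain ⟨hρ, u, hu, e⟩ := CtxSem.of_update hρ hx
    refine mem_semP_mono (interp_contr_superset x M ρ) (ih ?_)
    rw [e]
    exact CtxSem.scons (CtxSem.scons hρ hu) hu

theorem STyp.interp_ne_bot {Γ : SCtx} {M : Tm} {A : STy} (h : STyp Γ M A) {σ : Valuation}
    {ρ : Env} (hρ : ρ ∈ CtxSem Γ σ) : interp M ρ ≠ ⊥ :=
  ne_bot_of_semN (h.adequacy hρ)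

theorem STyp.exists_typ {Γ : SCtx} {M : Tm} {A : STy} (h : STyp Γ M A) :
    ∃ (Δ : Ctx) (B : ATy), Typ Δ M (some B) := by
  -- Any valuation will do, and the environment `⊤` realises every context.
  obtain ⟨B, Δ, -, hB⟩ := IFilter.ne_bot_iff.1 (h.interp_ne_bot
    (σ := fun _ => ⟨Set.univ, Set.univ_nonempty⟩) (ρ := fun _ => ⊤)
    fun _ B _ => ⟨Value.top, Value.top_mem_semP B _, rfl⟩)
  exact ⟨Δ, B, hB⟩

end ESub

theorem mainTheorem8 (Γ : ESub.SCtx) (M : ESub.Tm) (A : ESub.STy) (h : ESub.STyp Γ M A) :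
    (∀ (σ : ESub.Valuation) (ρ : ESub.Env), ρ ∈ ESub.CtxSem Γ σ → ESub.interp M ρ ≠ ⊥) ∧
    (∃ (Δ : ESub.Ctx) (B : ESub.ATy), ESub.Typ Δ M (some B)) ∧
    (M.IsPure → ESub.SNLambda M) ∧
    (M.IsLS → ESub.SNLS M) ∧
    (M.IsLinear → ESub.SNLxr M) := by
  obtain ⟨Δ, B, hM⟩ := h.exists_typ
  exact ⟨fun _ _ hρ => h.interp_ne_bot hρ, ⟨Δ, B, hM⟩, fun hp => (hM.snLS hp.isLS).snLambda,
    hM.snLS, hM.snLxr⟩
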